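/- Let $\Omega=(0,1)^2$, let $\alpha>0$, and let $f,g\in C(\overline\Omega)$ with $g=0$ on $\partial\Omega$. Suppose that $z,u,p\in C^6(\overline\Omega)$ solve the optimality (KKT) system of the elliptic control problem, $$-\Delta z-u=f,\qquad -\Delta p+z=g,\qquad \alpha u-p=0\quad\text{in }\Omega,\qquad z=p=0\quad\text{on }\partial\Omega .$$ For an integer $N\ge 1$ put $h=1/N$ and consider the grid points $(ih,jh)$, $0\le i,j\le N$, the interior ones being those with $1\le i,j\le N-1$. Let $\Delta_h$, $F_h$, $R_h$ be the operators with stencils $$\Delta_h=\frac1{h^{2}}\begin{bmatrix}0&1&0\\1&-4&1\\0&1&0\end{bmatrix},\qquad F_h=\frac1{6h^{2}}\begin{bmatrix}-1&-4&-1\\-4&20&-4\\-1&-4&-1\end{bmatrix},\qquad R_h=\frac1{12}\begin{bmatrix}0&1&0\\1&8&1\\0&1&0\end{bmatrix},$$ let $I_h$ be the identity, let $f_h,g_h$ be the values of $f,g$ at the grid points (boundary points included), and let $\|v\|_\infty=\max_{1\le i,j\le N-1}|v_{ij}|$ (with value $0$ if $N=1$). For $\gamma\ge 0$ the $H^1$-regularized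 trapezoidal discretize-then-optimize scheme (DO-4-Trap-Reg) is the linear system, at all interior grid points, $$F_hz_h-R_hu_h=R_hf_h,\qquad F_hp_h+(I_h-\gamma\Delta_h)z_h=(I_h-\gamma\Delta_h)g_h,\qquad \alpha(I_h-\gamma\Delta_h)u_h-R_hp_h=0,$$ for grid functions $z_h,u_h,p_h$ that vanish at the boundary grid points. Then the system has a unique solution $(z_h,u_h,p_h)$ for all $N\ge1$ and $\gamma\ge0$, and there is a constant $C$, independent of $h$ and of $\gamma$, such that for all $N\ge 1$ and all $\gamma\ge 0$ (in particular for the choice $\gamma=h^{-2}$) $$\|z-z_h\|_\infty\le Ch^4\qquad\text{and}\qquad \|u-u_h\|_\infty\le Ch^4 .$$ -/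

import Mathlib

open scoped NNReal

namespace EllipticControl

/-- The open unit square `Ω = (0,1)²` in the Euclidean plane. -/
def unitSquare : Set (EuclideanSpace ℝ (Fin 2)) :=
  {x | ∀ k, x k ∈ Set.Ioo (0 : ℝ) 1}

/-- `(z, u, p)` is a solution of class `C⁶(Ω̄)` of the first-order optimality (KKT) system
with regularization parameter `α`, source term `f` and desired state `g`. -/
structure IsC6KKTSolution (α : ℝ) (f g z u p : EuclideanSpace ℝ (Fin 2) → ℝ) : Prop where
  z_smooth : ContDiffOn ℝ 6 z (closure unitSquare)
  u_smooth : ContDiffOn ℝ 6 u (closure unitSquare)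
  p_smooth : ContDiffOn ℝ 6 p (closure unitSquare)
  state : ∀ x ∈ unitSquare, -(Laplacian.laplacian z x) - u x = f x
  state_bdry : ∀ x ∈ frontier unitSquare, z x = 0
  adjoint : ∀ x ∈ unitSquare, -(Laplacian.laplacian p x) + z x = g x
  adjoint_bdry : ∀ x ∈ frontier unitSquare, p x = 0
  gradient : ∀ x ∈ unitSquare, α * u x - p x = 0

/-- Grid functions are indexed by `ℤ × ℤ`; only the indices `0 ≤ i, j ≤ N` ever matter. -/
abbrev GridFun : Type := ℤ → ℤ → ℝ

/-- Indices of the interior grid points: `1 ≤ i, j ≤ N - 1`. -/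
noncomputable def interiorIdx (N : ℕ) : Finset (ℤ × ℤ) :=
  Finset.Icc (1 : ℤ) ((N : ℤ) - 1) ×ˢ Finset.Icc (1 : ℤ) ((N : ℤ) - 1)

/-- The restriction of a function to the grid points `(i h, j h)`. -/
noncomputable def sample (h : ℝ) (w : EuclideanSpace ℝ (Fin 2) → ℝ) : GridFun :=
  fun i j => w !₂[(i : ℝ) * h, (j : ℝ) * h]

/-- The 5-point discrete Laplacian `Δ_h`. -/
noncomputable def discLaplacian (h : ℝ) (v : GridFun) : GridFun := fun i j =>
  (v (i + 1) j + v (i - 1) j + v i (j + 1) + v i (j - 1) - 4 * v i j) / h ^ 2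

/-- The compact 9-point discrete negative Laplacian `F_h`. -/
noncomputable def opF (h : ℝ) (v : GridFun) : GridFun := fun i j =>
  (20 * v i j
    - 4 * (v (i + 1) j + v (i - 1) j + v i (j + 1) + v i (j - 1))
    - (v (i + 1) (j + 1) + v (i + 1) (j - 1) + v (i - 1) (j + 1) + v (i - 1) (j - 1)))
    / (6 * h ^ 2)

/-- The averaging stencil `R_h`. -/
noncomputable def opR (v : GridFun) : GridFun := fun i j =>
  (8 * v i j + v (i + 1) j + v (i - 1) j + v i (j + 1) + v i (j - 1)) / 12

/-- The regularized weight `I_h - γ Δ_h`. -/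
noncomputable def regWeight (γ h : ℝ) (v : GridFun) : GridFun := fun i j =>
  v i j - γ * discLaplacian h v i j

/-- The maximum norm over the interior grid points. -/
noncomputable def maxNorm (N : ℕ) (v : GridFun) : ℝ :=
  (((interiorIdx N).sup fun ij => ‖v ij.1 ij.2‖₊ : ℝ≥0) : ℝ)

/-- `(z, u, p)` solves the `H¹`-regularized trapezoidal discrete optimality system with the
9-point discretization of the state equation on the grid of step size `h = 1 / N`, for the
grid data `f`, `g`. The unknowns live on the interior grid points and are extended by zero,
which enforces the homogeneous Dirichlet conditions. -/
structure IsDO4TrapRegSolution (α γ : ℝ) (N : ℕ) (f g z u p : GridFun) : Prop where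
  z_ext : ∀ i j, (i, j) ∉ interiorIdx N → z i j = 0
  u_ext : ∀ i j, (i, j) ∉ interiorIdx N → u i j = 0
  p_ext : ∀ i j, (i, j) ∉ interiorIdx N → p i j = 0
  state : ∀ i j, (i, j) ∈ interiorIdx N →
    opF (1 / N) z i j - opR u i j = opR f i j
  adjoint : ∀ i j, (i, j) ∈ interiorIdx N →
    opF (1 / N) p i j + regWeight γ (1 / N) z i j = regWeight γ (1 / N) g i j
  gradient : ∀ i j, (i, j) ∈ interiorIdx N →
    α * regWeight γ (1 / N) u i j - opR p i j = 0

end EllipticControl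

namespace EllipticControl

open Finset

/-! ### One-dimensional summation by parts -/

/-! Write `X` and `Y` for the negative second differences in the two directions and `L = X + Y`.
Then `h² F_h = L - XY/6`, `R_h = 1 - L/12` and `I_h - γ Δ_h = 1 + γ N² L`. On grid functions with
zero boundary values these are polynomials in two commuting operators, and the weight `W = I_h - γ
Δ_h` is positive definite.

Elimination of `p_h`. Applying `F_h` to the gradient equation and inserting the adjoint equation
gives `W (α F_h u_h - R_h (g_h - z_h)) = 0`. Since `W` is injective, `α F_h u_h + R_h z_h = R_h g_h`
(`IsDO4TrapRegSolution.control_eq`). Zero boundary values of `g` are what allow `W` and `R_h` to be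
commuted on `g_h - z_h`. From here on `γ` is absent, so every bound is uniform in it.

Stability (`coupled_stability`). The state and control equations are tested with `L z` and `L u`.
The coupling terms cancel in the sum because `L` is symmetric and `R_h` is a polynomial in it. The
operator `F_h` controls two thirds of `L` (`gridInner_secF_secL_ge`), and a discrete `H²` embedding
turns the energy bound into a maximum norm bound (`sq_le_gridInner_secL`).

Consistency (`IsDerivTable.consistency`). For `w` of class `C⁶`, `F_h w + R_h Δw` is of order `h⁴`,
by two Numerov estimates and two mixed remainders. It is applied to `z` and, through `p = α u`, to
`u`. The differential equations are first extended by continuity to the closed square, because `R_h`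
reads boundary values.

Solvability follows from the same stability estimate with zero data: the discrete system is square
and injective. -/

theorem sum_Icc_succ_shift (m : ℤ) (f : ℤ → ℝ) :
    ∑ i ∈ Icc 0 m, f (i + 1) = ∑ i ∈ Icc 1 (m + 1), f i := by
  have h : (Icc (0 : ℤ) m).map (addRightEmbedding 1) = Icc 1 (m + 1) := by
    rw [Finset.map_add_right_Icc]; simp
  rw [← h, Finset.sum_map]
  rfl

theorem sum_Icc_one_eq_of_zero_left {m : ℤ} (f : ℤ → ℝ) (h0 : f 0 = 0) :
    ∑ i ∈ Icc 1 m, f i = ∑ i ∈ Icc 0 m, f i := by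
  apply Finset.sum_subset
  · intro i; simp only [mem_Icc]; omega
  · intro i hi hi'
    have : i = 0 := by simp only [mem_Icc] at hi hi'; omega
    rw [this, h0]

theorem sum_Icc_one_eq_of_zero_right {m : ℤ} (f : ℤ → ℝ) (h0 : f (m + 1) = 0) :
    ∑ i ∈ Icc 1 m, f i = ∑ i ∈ Icc 1 (m + 1), f i := by
  apply Finset.sum_subset
  · intro i; simp only [mem_Icc]; omega
  · intro i hi hi'
    have : i = m + 1 := by simp only [mem_Icc] at hi hi'; omega
    rw [this, h0]

/-- Summation by parts for the negative second difference. -/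
theorem sum_secondDiff_mul {m : ℤ} (a b : ℤ → ℝ) (h0 : b 0 = 0) (hm : b (m + 1) = 0) :
    ∑ i ∈ Icc 1 m, (2 * a i - a (i + 1) - a (i - 1)) * b i
      = ∑ i ∈ Icc 0 m, (a (i + 1) - a i) * (b (i + 1) - b i) := by
  have h1 : ∑ i ∈ Icc 0 m, (a (i + 1) - a i) * b (i + 1)
      = ∑ i ∈ Icc 1 m, (a i - a (i - 1)) * b i := by
    rw [sum_Icc_one_eq_of_zero_right _ (by simp [hm]),
      ← sum_Icc_succ_shift m (fun i => (a i - a (i - 1)) * b i)]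
    simp
  have h2 : ∑ i ∈ Icc 0 m, (a (i + 1) - a i) * b i
      = ∑ i ∈ Icc 1 m, (a (i + 1) - a i) * b i := by
    rw [sum_Icc_one_eq_of_zero_left _ (by simp [h0])]
  simp only [mul_sub, Finset.sum_sub_distrib] at *
  rw [h1, h2, ← Finset.sum_sub_distrib]
  refine Finset.sum_congr rfl fun i _ => by ring

/-- A second difference is the difference of two neighbouring first differences, and `(x - y)² ≤ 2x²
+ 2y²`; each first difference is then counted at most twice. -/
theorem sum_secondDiff_sq_le (m : ℤ) (a : ℤ → ℝ) :
    ∑ i ∈ Icc 1 m, (2 * a i - a (i + 1) - a (i - 1)) ^ 2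
      ≤ 4 * ∑ i ∈ Icc 0 m, (a (i + 1) - a i) ^ 2 := by
  have h1 : ∑ i ∈ Icc 1 m, (a (i + 1) - a i) ^ 2 ≤ ∑ i ∈ Icc 0 m, (a (i + 1) - a i) ^ 2 :=
    Finset.sum_le_sum_of_subset_of_nonneg
      (by intro i; simp only [mem_Icc]; omega) (fun _ _ _ => sq_nonneg _)
  have h2 : ∑ i ∈ Icc 1 m, (a i - a (i - 1)) ^ 2 ≤ ∑ i ∈ Icc 0 m, (a (i + 1) - a i) ^ 2 := by
    have h := sum_Icc_succ_shift m (fun i => (a i - a (i - 1)) ^ 2)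
    simp only [add_sub_cancel_right] at h
    rw [h]
    exact Finset.sum_le_sum_of_subset_of_nonneg
      (by intro i; simp only [mem_Icc]; omega) (fun _ _ _ => sq_nonneg _)
  have h3 : ∑ i ∈ Icc 1 m, (2 * a i - a (i + 1) - a (i - 1)) ^ 2
      ≤ ∑ i ∈ Icc 1 m, (2 * (a (i + 1) - a i) ^ 2 + 2 * (a i - a (i - 1)) ^ 2) :=
    Finset.sum_le_sum fun i _ => by nlinarith [sq_nonneg (a (i + 1) - a (i - 1))]
  rw [Finset.sum_add_distrib, ← Finset.mul_sum, ← Finset.mul_sum] at h3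
  linarith

theorem abs_le_sum_abs_diff {m : ℤ} (a : ℤ → ℝ) (h0 : a 0 = 0) {i : ℤ} (hi : i ∈ Icc 0 m) :
    |a i| ≤ ∑ k ∈ Icc 0 m, |a (k + 1) - a k| := by
  have key : ∀ n : ℕ, a n = ∑ k ∈ range n, (a ((k : ℤ) + 1) - a k) := by
    intro n
    have := Finset.sum_range_sub (fun k : ℕ => a k) n
    simp only [Nat.cast_add, Nat.cast_one, Nat.cast_zero, h0, sub_zero] at this
    exact this.symm
  simp only [mem_Icc] at hi
  obtain ⟨n, rfl⟩ := Int.eq_ofNat_of_zero_le hi.1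
  rw [key n]
  refine (Finset.abs_sum_le_sum_abs _ _).trans ?_
  have : ∑ k ∈ range n, |a ((k : ℤ) + 1) - a k|
      = ∑ k ∈ (range n).map Nat.castEmbedding, |a ((k : ℤ) + 1) - a k| := by
    rw [Finset.sum_map]; rfl
  rw [this]
  refine Finset.sum_le_sum_of_subset_of_nonneg ?_ (fun _ _ _ => abs_nonneg _)
  intro k hk
  simp only [Finset.mem_map, Finset.mem_range, Nat.castEmbedding_apply] at hk
  obtain ⟨l, hl, rfl⟩ := hk
  simp only [mem_Icc]; omega

/-! ### Energy estimates on the grid -/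

/-- The negative second difference in the first index. -/
def secX (v : GridFun) : GridFun := fun i j => 2 * v i j - v (i + 1) j - v (i - 1) j

/-- The negative second difference in the second index. -/
def secY (v : GridFun) : GridFun := fun i j => 2 * v i j - v i (j + 1) - v i (j - 1)

/-- `-h² Δ_h`. -/
def secL (v : GridFun) : GridFun := fun i j => secX v i j + secY v i j

/-- `h² F_h`. -/
noncomputable def secF (v : GridFun) : GridFun :=
  fun i j => secX v i j + secY v i j - secX (secY v) i j / 6

/-- The unscaled inner product over the interior grid points. -/
noncomputable def gridInner (N : ℕ) (v w : GridFun) : ℝ :=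
  ∑ i ∈ Icc (1 : ℤ) (N - 1), ∑ j ∈ Icc (1 : ℤ) (N - 1), v i j * w i j

/-- The squared `ℓ²`-norm of the mixed forward difference. -/
noncomputable def mixedEnergy (N : ℕ) (v : GridFun) : ℝ :=
  ∑ i ∈ Icc (0 : ℤ) (N - 1), ∑ j ∈ Icc (0 : ℤ) (N - 1),
    (v (i + 1) (j + 1) - v (i + 1) j - v i (j + 1) + v i j) ^ 2

/-- Grid functions vanishing away from the interior grid points. -/
def VanishesOff (N : ℕ) (v : GridFun) : Prop := ∀ i j, (i, j) ∉ interiorIdx N → v i j = 0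

theorem mem_interiorIdx {N : ℕ} {i j : ℤ} :
    (i, j) ∈ interiorIdx N ↔ (1 ≤ i ∧ i ≤ N - 1) ∧ 1 ≤ j ∧ j ≤ N - 1 := by
  simp [interiorIdx]

theorem VanishesOff.left {N : ℕ} {v : GridFun} (hv : VanishesOff N v) {i : ℤ} (j : ℤ)
    (hi : ¬ (1 ≤ i ∧ i ≤ N - 1)) : v i j = 0 := hv i j (by rw [mem_interiorIdx]; tauto)

theorem VanishesOff.right {N : ℕ} {v : GridFun} (hv : VanishesOff N v) (i : ℤ) {j : ℤ}
    (hj : ¬ (1 ≤ j ∧ j ≤ N - 1)) : v i j = 0 := hv i j (by rw [mem_interiorIdx]; tauto)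

theorem VanishesOff.flip {N : ℕ} {v : GridFun} (hv : VanishesOff N v) :
    VanishesOff N (fun i j => v j i) := by
  intro i j hij
  apply hv
  rw [mem_interiorIdx] at *; tauto

theorem gridInner_flip (N : ℕ) (v w : GridFun) :
    gridInner N (fun i j => v j i) (fun i j => w j i) = gridInner N v w := by
  unfold gridInner; rw [Finset.sum_comm]

theorem mixedEnergy_flip (N : ℕ) (v : GridFun) :
    mixedEnergy N (fun i j => v j i) = mixedEnergy N v := by
  unfold mixedEnergy; rw [Finset.sum_comm]
  refine Finset.sum_congr rfl fun i _ => Finset.sum_congr rfl fun j _ => by ring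

theorem gridInner_comm (N : ℕ) (v w : GridFun) : gridInner N v w = gridInner N w v := by
  unfold gridInner
  refine Finset.sum_congr rfl fun i _ => Finset.sum_congr rfl fun j _ => by ring

theorem gridInner_self_nonneg (N : ℕ) (v : GridFun) : 0 ≤ gridInner N v v :=
  Finset.sum_nonneg fun _ _ => Finset.sum_nonneg fun _ _ => mul_self_nonneg _

/-- Only `w` needs boundary values, and only at the two ends of the first index. This admits `w =
secY v`, which need not vanish at the ends of the second index. -/
theorem gridInner_secX_left {N : ℕ} (v : GridFun) {w : GridFun}
    (h0 : ∀ j, w 0 j = 0) (hN : ∀ j, w N j = 0) :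
    gridInner N (secX v) w = ∑ j ∈ Icc (1 : ℤ) (N - 1), ∑ i ∈ Icc (0 : ℤ) (N - 1),
      (v (i + 1) j - v i j) * (w (i + 1) j - w i j) := by
  unfold gridInner
  rw [Finset.sum_comm]
  refine Finset.sum_congr rfl fun j _ => ?_
  exact sum_secondDiff_mul (fun i => v i j) (fun i => w i j) (h0 j) (by simpa using hN j)

theorem gridInner_secX_symm {N : ℕ} {v w : GridFun} (hv : VanishesOff N v)
    (hw : VanishesOff N w) : gridInner N (secX v) w = gridInner N v (secX w) := by
  rw [gridInner_comm N v, gridInner_secX_left v (fun j => hw.left j (by omega))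
    (fun j => hw.left j (by omega)), gridInner_secX_left w (fun j => hv.left j (by omega))
    (fun j => hv.left j (by omega))]
  refine Finset.sum_congr rfl fun i _ => Finset.sum_congr rfl fun j _ => by ring

theorem gridInner_secY_eq_flip (N : ℕ) (v w : GridFun) :
    gridInner N (secY v) w = gridInner N (secX fun i j => v j i) (fun i j => w j i) := by
  rw [← gridInner_flip]; rfl

theorem gridInner_secY_symm {N : ℕ} {v w : GridFun} (hv : VanishesOff N v)
    (hw : VanishesOff N w) : gridInner N (secY v) w = gridInner N v (secY w) := by
  rw [gridInner_secY_eq_flip, gridInner_secX_symm hv.flip hw.flip, gridInner_comm,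
    ← gridInner_secY_eq_flip, gridInner_comm]

theorem gridInner_add_left (N : ℕ) (v w x : GridFun) :
    gridInner N (fun i j => v i j + w i j) x = gridInner N v x + gridInner N w x := by
  simp only [gridInner, add_mul, Finset.sum_add_distrib]

theorem gridInner_smul_left (N : ℕ) (c : ℝ) (v x : GridFun) :
    gridInner N (fun i j => c * v i j) x = c * gridInner N v x := by
  simp only [gridInner, mul_assoc, Finset.mul_sum]

theorem gridInner_add_right (N : ℕ) (v w x : GridFun) :
    gridInner N x (fun i j => v i j + w i j) = gridInner N x v + gridInner N x w := by
  simp only [gridInner, mul_add, Finset.sum_add_distrib]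

theorem gridInner_congr_left {N : ℕ} {v w : GridFun} (x : GridFun)
    (h : ∀ i j, (i, j) ∈ interiorIdx N → v i j = w i j) :
    gridInner N v x = gridInner N w x := by
  unfold gridInner
  refine Finset.sum_congr rfl fun i hi => Finset.sum_congr rfl fun j hj => ?_
  rw [h i j]; simp only [interiorIdx, Finset.mem_product]; exact ⟨hi, hj⟩

theorem gridInner_secL_symm {N : ℕ} {v w : GridFun} (hv : VanishesOff N v)
    (hw : VanishesOff N w) : gridInner N (secL v) w = gridInner N v (secL w) := by
  unfold secL
  rw [gridInner_add_left, gridInner_add_right, gridInner_secX_symm hv hw,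
    gridInner_secY_symm hv hw]

theorem gridInner_secL_self_nonneg {N : ℕ} {v : GridFun} (hv : VanishesOff N v) :
    0 ≤ gridInner N (secL v) v := by
  unfold secL
  rw [gridInner_add_left, gridInner_secY_eq_flip,
    gridInner_secX_left v (fun j => hv.left j (by omega)) (fun j => hv.left j (by omega)),
    gridInner_secX_left _ (fun j => hv.flip.left j (by omega))
      (fun j => hv.flip.left j (by omega))]
  exact add_nonneg (Finset.sum_nonneg fun _ _ => Finset.sum_nonneg fun _ _ => mul_self_nonneg _)
    (Finset.sum_nonneg fun _ _ => Finset.sum_nonneg fun _ _ => mul_self_nonneg _)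

/-- Summation by parts once in each direction. In particular the cross term in the square of `secL
v` is nonnegative. -/
theorem gridInner_secX_secY {N : ℕ} {v : GridFun} (hv : VanishesOff N v) :
    gridInner N (secX v) (secY v) = mixedEnergy N v := by
  have hl : ∀ {i : ℤ} (j : ℤ), ¬ (1 ≤ i ∧ i ≤ N - 1) → secY v i j = 0 := by
    intro i j hi; simp [secY, hv.left _ hi]
  rw [gridInner_secX_left v (fun j => hl j (by omega)) (fun j => hl j (by omega)),
    Finset.sum_comm]
  unfold mixedEnergy
  refine Finset.sum_congr rfl fun i _ => ?_
  have := sum_secondDiff_mul (m := (N : ℤ) - 1) (fun j => v (i + 1) j - v i j)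
    (fun j => v (i + 1) j - v i j)
    (by simp [hv.right _ (show ¬ (1 ≤ (0 : ℤ) ∧ (0 : ℤ) ≤ N - 1) by omega)])
    (by simp [hv.right _ (show ¬ (1 ≤ (N : ℤ) ∧ (N : ℤ) ≤ N - 1) by omega)])
  refine Eq.trans ?_ (this.trans ?_)
  · refine Finset.sum_congr rfl fun j _ => by unfold secY; ring
  · refine Finset.sum_congr rfl fun j _ => by ring

/-- Summation by parts in the second index leaves the square of the `y`-difference of `secX v`. This
is the second `x`-difference of a `y`-difference, so `sum_secondDiff_sq_le` reduces it to the mixed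
difference at the cost of a factor 4. -/
theorem gridInner_secX_secY_secX_le {N : ℕ} {v : GridFun} (hv : VanishesOff N v) :
    gridInner N (secX (secY v)) (secX v) ≤ 4 * mixedEnergy N v := by
  have h1 : gridInner N (secX (secY v)) (secX v) = ∑ i ∈ Icc (1 : ℤ) (N - 1),
      ∑ j ∈ Icc (0 : ℤ) (N - 1), (secX v i (j + 1) - secX v i j) ^ 2 := by
    unfold gridInner
    refine Finset.sum_congr rfl fun i _ => ?_
    have h0 : ∀ {j : ℤ}, ¬ (1 ≤ j ∧ j ≤ N - 1) → secX v i j = 0 := by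
      intro j hj; simp [secX, hv.right _ hj]
    have := sum_secondDiff_mul (m := (N : ℤ) - 1) (fun j => secX v i j) (fun j => secX v i j)
      (h0 (by omega)) (h0 (by omega))
    refine Eq.trans ?_ (this.trans ?_)
    · refine Finset.sum_congr rfl fun j _ => by unfold secX secY; ring
    · refine Finset.sum_congr rfl fun j _ => by ring
  have h2 : mixedEnergy N v = ∑ j ∈ Icc (0 : ℤ) (N - 1), ∑ i ∈ Icc (0 : ℤ) (N - 1),
      (v (i + 1) (j + 1) - v (i + 1) j - v i (j + 1) + v i j) ^ 2 := Finset.sum_comm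
  rw [h1, h2, Finset.sum_comm, Finset.mul_sum]
  refine Finset.sum_le_sum fun j _ => ?_
  have := sum_secondDiff_sq_le ((N : ℤ) - 1) (fun i => v i (j + 1) - v i j)
  refine le_of_eq_of_le ?_ (this.trans (le_of_eq ?_))
  · refine Finset.sum_congr rfl fun i _ => by unfold secX; ring
  · congr 1; refine Finset.sum_congr rfl fun i _ => by ring

theorem gridInner_secX_secY_secY_le {N : ℕ} {v : GridFun} (hv : VanishesOff N v) :
    gridInner N (secX (secY v)) (secY v) ≤ 4 * mixedEnergy N v := by
  have := gridInner_secX_secY_secX_le hv.flip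
  rw [mixedEnergy_flip] at this
  refine le_of_eq_of_le ?_ this
  rw [← gridInner_flip]
  refine gridInner_congr_left _ fun i j _ => ?_
  simp only [secX, secY]; ring

theorem gridInner_secL_self_eq {N : ℕ} {v : GridFun} (hv : VanishesOff N v) :
    gridInner N (secL v) (secL v)
      = gridInner N (secX v) (secX v) + gridInner N (secY v) (secY v) + 2 * mixedEnergy N v := by
  unfold secL
  rw [gridInner_add_left, gridInner_add_right, gridInner_add_right,
    gridInner_comm N (secY v) (secX v), gridInner_secX_secY hv]
  ring

/-- The square of `secX v - secY v` is nonnegative, and both cross terms equal the mixed energy. -/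
theorem four_mul_mixedEnergy_le {N : ℕ} {v : GridFun} (hv : VanishesOff N v) :
    4 * mixedEnergy N v ≤ gridInner N (secL v) (secL v) := by
  have h : 0 ≤ gridInner N (secX v) (secX v) + gridInner N (secY v) (secY v)
      - 2 * gridInner N (secX v) (secY v) := by
    have : gridInner N (secX v) (secX v) + gridInner N (secY v) (secY v)
        - 2 * gridInner N (secX v) (secY v)
        = gridInner N (fun i j => secX v i j - secY v i j) (fun i j => secX v i j - secY v i j) := by
      unfold gridInner
      rw [Finset.mul_sum, ← Finset.sum_add_distrib, ← Finset.sum_sub_distrib]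
      refine Finset.sum_congr rfl fun i _ => ?_
      rw [Finset.mul_sum, ← Finset.sum_add_distrib, ← Finset.sum_sub_distrib]
      refine Finset.sum_congr rfl fun j _ => by ring
    rw [this]; exact gridInner_self_nonneg _ _
  rw [gridInner_secX_secY hv] at h
  rw [gridInner_secL_self_eq hv]
  linarith

/-- The nine-point operator dominates two thirds of the five-point one. -/
theorem gridInner_secF_secL_ge {N : ℕ} {v : GridFun} (hv : VanishesOff N v) :
    2 / 3 * gridInner N (secL v) (secL v) ≤ gridInner N (secF v) (secL v) := by
  have h1 : gridInner N (secF v) (secL v) = gridInner N (secL v) (secL v)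
      + (-1 / 6) * gridInner N (secX (secY v)) (secL v) := by
    rw [← gridInner_smul_left, ← gridInner_add_left]
    refine gridInner_congr_left _ fun i j _ => ?_
    simp only [secF, secL]; ring
  have h2 : gridInner N (secX (secY v)) (secL v) ≤ 8 * mixedEnergy N v := by
    have := gridInner_add_right N (secX v) (secY v) (secX (secY v))
    unfold secL
    rw [this]
    linarith [gridInner_secX_secY_secX_le hv, gridInner_secX_secY_secY_le hv]
  -- The correction `XY/6` costs at most `8/6` of the mixed energy, hence one third of the full
  -- energy.
  have h3 := four_mul_mixedEnergy_le hv
  rw [h1]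
  linarith

/-- Discrete embedding of `H²` into the bounded functions. -/
theorem sq_le_gridInner_secL {N : ℕ} {v : GridFun} (hv : VanishesOff N v) (i j : ℤ) :
    v i j ^ 2 ≤ (N : ℝ) ^ 2 / 4 * gridInner N (secL v) (secL v) := by
  by_cases hij : (i, j) ∈ interiorIdx N
  swap
  · rw [hv i j hij]
    exact (zero_pow two_ne_zero).trans_le (mul_nonneg (by positivity) (gridInner_self_nonneg N (secL v)))
  rw [mem_interiorIdx] at hij
  set J := Icc (0 : ℤ) (N - 1) with hJ
  set d : ℤ → ℤ → ℝ := fun i j => v (i + 1) (j + 1) - v (i + 1) j - v i (j + 1) + v i j with hd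
  have hcard : (#J : ℝ) = N := by
    rw [hJ, Int.card_Icc]
    simp
  -- Telescoping from the zero boundary in both directions writes `v i j` as a sum of mixed
  -- differences over grid cells.
  have h1 : |v i j| ≤ ∑ k ∈ J, ∑ l ∈ J, |d k l| := by
    refine (abs_le_sum_abs_diff (m := (N : ℤ) - 1) (fun i => v i j)
      (hv.left j (by omega)) (by simp only [mem_Icc]; omega)).trans ?_
    refine Finset.sum_le_sum fun k _ => ?_
    refine (abs_le_sum_abs_diff (m := (N : ℤ) - 1) (fun j => v (k + 1) j - v k j)
      (by simp [hv.right _ (show ¬ (1 ≤ (0 : ℤ) ∧ (0 : ℤ) ≤ N - 1) by omega)])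
      (i := j) (by simp only [mem_Icc]; omega)).trans (le_of_eq ?_)
    refine Finset.sum_congr rfl fun l _ => ?_
    congr 1; simp only [hd]; ring
  -- Cauchy–Schwarz over the `N²` cells.
  have h2 : (∑ k ∈ J, ∑ l ∈ J, |d k l|) ^ 2 ≤ (N : ℝ) ^ 2 * mixedEnergy N v := by
    have e : ∑ k ∈ J, ∑ l ∈ J, |d k l| = ∑ x ∈ J ×ˢ J, |d x.1 x.2| := by
      rw [Finset.sum_product]
    have e' : mixedEnergy N v = ∑ x ∈ J ×ˢ J, |d x.1 x.2| ^ 2 := by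
      rw [Finset.sum_product]; simp only [sq_abs]; rfl
    rw [e, e']
    refine (sq_sum_le_card_mul_sum_sq).trans (le_of_eq ?_)
    rw [Finset.card_product]; push_cast; rw [hcard]; ring
  have h3 := four_mul_mixedEnergy_le hv
  have h4 : v i j ^ 2 ≤ (∑ k ∈ J, ∑ l ∈ J, |d k l|) ^ 2 := by
    rw [← sq_abs (v i j)]; exact pow_le_pow_left₀ (abs_nonneg _) h1 2
  have h5 : (N : ℝ) ^ 2 * (4 * mixedEnergy N v)
      ≤ (N : ℝ) ^ 2 * gridInner N (secL v) (secL v) := by gcongr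
  linarith

/-! ### Maximum norm stability of the discrete equations. -/

theorem opF_eq_secF (h : ℝ) (v : GridFun) (i j : ℤ) : opF h v i j = secF v i j / h ^ 2 := by
  simp only [opF, secF, secX, secY, ← div_div]; congr 1; ring

theorem opR_eq_secL (v : GridFun) (i j : ℤ) : opR v i j = v i j + (-1 / 12) * secL v i j := by
  simp only [opR, secL, secX, secY]; ring

theorem eq_zero_of_opF_eq_zero {N : ℕ} (hN : 1 ≤ N) {v : GridFun} (hv : VanishesOff N v)
    (h : ∀ i j, (i, j) ∈ interiorIdx N → opF (1 / N) v i j = 0) : v = 0 := by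
  have hN' : (N : ℝ) ≠ 0 := by positivity
  have h1 : gridInner N (secF v) (secL v) = 0 := by
    have : gridInner N (secF v) (secL v) = gridInner N (fun _ _ => 0) (secL v) := by
      refine gridInner_congr_left _ fun i j hij => ?_
      have := h i j hij
      rw [opF_eq_secF] at this
      exact (div_eq_zero_iff.1 this).resolve_right (by positivity)
    rw [this]; simp [gridInner]
  have h2 := gridInner_secF_secL_ge hv
  have h3 := gridInner_self_nonneg N (secL v)
  have h4 : gridInner N (secL v) (secL v) = 0 := by linarith
  funext i j
  have := sq_le_gridInner_secL hv i j
  rw [h4, mul_zero] at this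
  exact pow_eq_zero_iff two_ne_zero |>.1 (le_antisymm this (sq_nonneg _))

/-- Young's inequality, weighted so that `c / 3` can be absorbed into the coercivity constant `2 /
3` and still leave one third. -/
theorem gridInner_le_of_abs_le {N : ℕ} {t w : GridFun} {τ c : ℝ} (hc : 0 < c)
    (ht : ∀ i j, (i, j) ∈ interiorIdx N → |t i j| ≤ τ) :
    gridInner N t w ≤ 3 / (4 * c) * ((N : ℝ) ^ 2 * τ ^ 2) + c / 3 * gridInner N w w := by
  unfold gridInner
  have hcard : (#(Icc (1 : ℤ) (N - 1)) : ℝ) ≤ N := by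
    have : #(Icc (1 : ℤ) (N - 1)) ≤ N := by rw [Int.card_Icc]; omega
    exact_mod_cast this
  have h1 : ∑ i ∈ Icc (1 : ℤ) (N - 1), ∑ j ∈ Icc (1 : ℤ) (N - 1), t i j * w i j
      ≤ ∑ i ∈ Icc (1 : ℤ) (N - 1), ∑ j ∈ Icc (1 : ℤ) (N - 1),
        (3 / (4 * c) * τ ^ 2 + c / 3 * (w i j * w i j)) := by
    refine Finset.sum_le_sum fun i hi => Finset.sum_le_sum fun j hj => ?_
    have h := ht i j (by simp only [interiorIdx, Finset.mem_product]; exact ⟨hi, hj⟩)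
    have h' : t i j ^ 2 ≤ τ ^ 2 := by
      rw [← sq_abs (t i j)]; exact pow_le_pow_left₀ (abs_nonneg _) h 2
    have e : 3 / (4 * c) * t i j ^ 2 + c / 3 * (w i j * w i j) - t i j * w i j
        = 3 / (4 * c) * (t i j - 2 * c / 3 * w i j) ^ 2 := by field_simp; ring
    have e1 : 0 ≤ 3 / (4 * c) * (t i j - 2 * c / 3 * w i j) ^ 2 := by positivity
    have e2 : 3 / (4 * c) * t i j ^ 2 ≤ 3 / (4 * c) * τ ^ 2 := by gcongr
    linarith
  refine h1.trans ?_
  simp only [Finset.sum_add_distrib, Finset.sum_const, nsmul_eq_mul, Finset.mul_sum]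
  gcongr ?_ + _
  have h0 : (0 : ℝ) ≤ #(Icc (1 : ℤ) (N - 1)) := by positivity
  calc (#(Icc (1 : ℤ) (N - 1)) : ℝ) * (#(Icc (1 : ℤ) (N - 1)) * (3 / (4 * c) * τ ^ 2))
      ≤ N * (N * (3 / (4 * c) * τ ^ 2)) := by gcongr
    _ = _ := by ring

/-- Maximum norm stability of the coupled state and control equations. -/
theorem coupled_stability {α : ℝ} (hα : 0 < α) {N : ℕ} (hN : 1 ≤ N) {z u : GridFun}
    (hz : VanishesOff N z) (hu : VanishesOff N u) {τ : ℝ} (hτ : 0 ≤ τ)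
    (h1 : ∀ i j, (i, j) ∈ interiorIdx N → |opF (1 / N) z i j - opR u i j| ≤ τ)
    (h2 : ∀ i j, (i, j) ∈ interiorIdx N → |α * opF (1 / N) u i j + opR z i j| ≤ τ) (i j : ℤ) :
    |z i j| ≤ (1 + 1 / α) * τ ∧ |u i j| ≤ (1 + 1 / α) * τ := by
  have hN' : (0 : ℝ) < N := by positivity
  set t₁ : GridFun := fun i j => opF (1 / N) z i j - opR u i j with ht₁
  set t₂ : GridFun := fun i j => α * opF (1 / N) u i j + opR z i j with ht₂
  have e1 : gridInner N (secF z) (secL z) = (1 / (N : ℝ) ^ 2) * (gridInner N t₁ (secL z)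
      + (gridInner N u (secL z) + (-1 / 12) * gridInner N (secL u) (secL z))) := by
    rw [← gridInner_smul_left, ← gridInner_add_left, ← gridInner_add_left, ← gridInner_smul_left]
    refine gridInner_congr_left _ fun i j _ => ?_
    simp only [ht₁, opF_eq_secF, opR_eq_secL]; field_simp; ring
  have e2 : α * gridInner N (secF u) (secL u) = (1 / (N : ℝ) ^ 2) * (gridInner N t₂ (secL u)
      + (-1) * (gridInner N z (secL u) + (-1 / 12) * gridInner N (secL z) (secL u))) := by
    rw [← gridInner_smul_left, ← gridInner_smul_left, ← gridInner_add_left, ← gridInner_smul_left,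
      ← gridInner_add_left, ← gridInner_smul_left]
    refine gridInner_congr_left _ fun i j _ => ?_
    simp only [ht₂, opF_eq_secF, opR_eq_secL]; field_simp; ring
  -- With `e4`, this makes the coupling terms of `e1` and `e2` cancel in their sum. The factor `α`
  -- in `e2` enters only as the weight of the `u`-energy.
  have e3 : gridInner N z (secL u) = gridInner N u (secL z) := by
    rw [← gridInner_secL_symm hz hu, gridInner_comm]
  have e4 := gridInner_comm N (secL z) (secL u)
  have c1 := gridInner_secF_secL_ge hz
  have c2 := gridInner_secF_secL_ge hu
  set A := gridInner N (secL z) (secL z) with hA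
  set B := gridInner N (secL u) (secL u) with hB
  have hA0 : 0 ≤ A := gridInner_self_nonneg _ _
  have hB0 : 0 ≤ B := gridInner_self_nonneg _ _
  have b1 : (1 / (N : ℝ) ^ 2) * gridInner N t₁ (secL z) ≤ 3 / 4 * (τ ^ 2 / N ^ 2) + A / 3 := by
    have := gridInner_le_of_abs_le (w := secL z) (c := (N : ℝ) ^ 2) (by positivity) h1
    refine (mul_le_mul_of_nonneg_left this (by positivity)).trans (le_of_eq ?_)
    rw [← hA]; field_simp
  have b2 : (1 / (N : ℝ) ^ 2) * gridInner N t₂ (secL u)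
      ≤ 3 / 4 * (τ ^ 2 / N ^ 2) / α + α * B / 3 := by
    have := gridInner_le_of_abs_le (w := secL u) (c := α * (N : ℝ) ^ 2) (by positivity) h2
    refine (mul_le_mul_of_nonneg_left this (by positivity)).trans (le_of_eq ?_)
    rw [← hB]; field_simp
  have c2' : α * (2 / 3 * B) ≤ α * gridInner N (secF u) (secL u) := by gcongr
  have key : A + α * B ≤ 9 / 4 * (τ ^ 2 / N ^ 2) * (1 + 1 / α) := by
    have : (1 / (N : ℝ) ^ 2) * (gridInner N t₁ (secL z)
        + (gridInner N u (secL z) + (-1 / 12) * gridInner N (secL u) (secL z)))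
        + (1 / (N : ℝ) ^ 2) * (gridInner N t₂ (secL u)
        + (-1) * (gridInner N z (secL u) + (-1 / 12) * gridInner N (secL z) (secL u)))
        = (1 / (N : ℝ) ^ 2) * gridInner N t₁ (secL z)
          + (1 / (N : ℝ) ^ 2) * gridInner N t₂ (secL u) := by
      rw [e3, e4]; ring
    have e : 9 / 4 * (τ ^ 2 / N ^ 2) * (1 + 1 / α)
        = 3 * (3 / 4 * (τ ^ 2 / N ^ 2) + 3 / 4 * (τ ^ 2 / N ^ 2) / α) := by ring
    rw [e]
    linarith
  have hα' : 0 < 1 / α := by positivity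
  have kz := sq_le_gridInner_secL hz i j
  have ku := sq_le_gridInner_secL hu i j
  rw [← hA] at kz
  rw [← hB] at ku
  -- The embedding constant `N² / 4` cancels the `1 / N²` in `key`; the remaining factor `9 / 16` is
  -- dropped.
  have key' : (N : ℝ) ^ 2 / 4 * A + α * ((N : ℝ) ^ 2 / 4 * B) ≤ τ ^ 2 * (1 + 1 / α) := by
    have : (N : ℝ) ^ 2 / 4 * (A + α * B)
        ≤ (N : ℝ) ^ 2 / 4 * (9 / 4 * (τ ^ 2 / N ^ 2) * (1 + 1 / α)) := by gcongr
    have e : (N : ℝ) ^ 2 / 4 * (9 / 4 * (τ ^ 2 / N ^ 2) * (1 + 1 / α))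
        = 9 / 16 * (τ ^ 2 * (1 + 1 / α)) := by field_simp; ring
    have : 0 ≤ τ ^ 2 * (1 + 1 / α) := by positivity
    linarith
  have pA : 0 ≤ (N : ℝ) ^ 2 / 4 * A := by positivity
  have pB : 0 ≤ (N : ℝ) ^ 2 / 4 * B := by positivity
  have pt : 0 ≤ τ ^ 2 * (1 / α) := by positivity
  constructor
  · refine abs_le_of_sq_le_sq ?_ (by positivity)
    have : 0 ≤ α * ((N : ℝ) ^ 2 / 4 * B) := by positivity
    have : 0 ≤ τ ^ 2 * (1 / α) * (1 / α) := by positivity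
    nlinarith
  · refine abs_le_of_sq_le_sq ?_ (by positivity)
    have h : (1 / α) * (α * ((N : ℝ) ^ 2 / 4 * B)) ≤ (1 / α) * (τ ^ 2 * (1 + 1 / α)) :=
      mul_le_mul_of_nonneg_left (by linarith) hα'.le
    have e : (1 / α) * (α * ((N : ℝ) ^ 2 / 4 * B)) = (N : ℝ) ^ 2 / 4 * B := by field_simp
    have e' : ((1 + 1 / α) * τ) ^ 2
        = (1 / α) * (τ ^ 2 * (1 + 1 / α)) + (τ ^ 2 + τ ^ 2 * (1 / α)) := by ring
    rw [e']
    linarith [sq_nonneg τ]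

end EllipticControl

namespace EllipticControl

open Finset

/-! ### Elimination of the adjoint variable -/

/-- `opF` as a linear map. -/
noncomputable def opFLin (h : ℝ) : Module.End ℝ GridFun where
  toFun := opF h
  map_add' v w := by funext i j; simp only [opF, Pi.add_apply]; ring
  map_smul' c v := by
    funext i j; simp only [opF, Pi.smul_apply, smul_eq_mul, RingHom.id_apply]; ring

/-- `opR` as a linear map. -/
noncomputable def opRLin : Module.End ℝ GridFun where
  toFun := opR
  map_add' v w := by funext i j; simp only [opR, Pi.add_apply]; ring
  map_smul' c v := by
    funext i j; simp only [opR, Pi.smul_apply, smul_eq_mul, RingHom.id_apply]; ring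

/-- `regWeight` as a linear map. -/
noncomputable def regWeightLin (γ h : ℝ) : Module.End ℝ GridFun where
  toFun := regWeight γ h
  map_add' v w := by
    funext i j; simp only [regWeight, discLaplacian, Pi.add_apply]; ring
  map_smul' c v := by
    funext i j
    simp only [regWeight, discLaplacian, Pi.smul_apply, smul_eq_mul, RingHom.id_apply]; ring

theorem opF_sub (h : ℝ) (v w : GridFun) : opF h (v - w) = opF h v - opF h w :=
  (opFLin h).map_sub v w

theorem opR_sub (v w : GridFun) : opR (v - w) = opR v - opR w := opRLin.map_sub v w

theorem regWeight_sub (γ h : ℝ) (v w : GridFun) :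
    regWeight γ h (v - w) = regWeight γ h v - regWeight γ h w := (regWeightLin γ h).map_sub v w

/-! ### Commuting difference operators that preserve zero boundary values. -/

/-- The second difference in the first index, cut off to the interior indices. -/
noncomputable def truncX (N : ℕ) : Module.End ℝ GridFun where
  toFun v := fun i j => if 1 ≤ i ∧ i ≤ (N : ℤ) - 1 then secX v i j else 0
  map_add' v w := by
    funext i j; simp only [secX, Pi.add_apply]; split_ifs <;> ring
  map_smul' c v := by
    funext i j
    simp only [secX, Pi.smul_apply, smul_eq_mul, RingHom.id_apply]; split_ifs <;> ring

/-- The second difference in the second index, cut off to the interior indices. -/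
noncomputable def truncY (N : ℕ) : Module.End ℝ GridFun where
  toFun v := fun i j => if 1 ≤ j ∧ j ≤ (N : ℤ) - 1 then secY v i j else 0
  map_add' v w := by
    funext i j; simp only [secY, Pi.add_apply]; split_ifs <;> ring
  map_smul' c v := by
    funext i j
    simp only [secY, Pi.smul_apply, smul_eq_mul, RingHom.id_apply]; split_ifs <;> ring

theorem truncX_apply (N : ℕ) (v : GridFun) (i j : ℤ) :
    truncX N v i j = if 1 ≤ i ∧ i ≤ (N : ℤ) - 1 then secX v i j else 0 := rfl

theorem truncY_apply (N : ℕ) (v : GridFun) (i j : ℤ) :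
    truncY N v i j = if 1 ≤ j ∧ j ≤ (N : ℤ) - 1 then secY v i j else 0 := rfl

/-- Each operator acts, and is cut off, in its own index only. This tensor structure makes them
commute on all grid functions, without any boundary condition. -/
theorem commute_truncX_truncY (N : ℕ) : Commute (truncX N) (truncY N) := by
  refine LinearMap.ext fun v => ?_
  funext i j
  simp only [Module.End.mul_apply, truncX_apply, truncY_apply, secX, secY]
  split_ifs <;> ring

theorem truncX_vanishesOff {N : ℕ} {v : GridFun} (hv : VanishesOff N v) :
    VanishesOff N (truncX N v) := by
  intro i j hij
  rw [mem_interiorIdx, not_and_or] at hij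
  rw [truncX_apply]
  rcases hij with h | h
  · rw [if_neg h]
  · simp [secX, hv.right _ h]

theorem truncY_vanishesOff {N : ℕ} {v : GridFun} (hv : VanishesOff N v) :
    VanishesOff N (truncY N v) := by
  intro i j hij
  rw [mem_interiorIdx, not_and_or] at hij
  rw [truncY_apply]
  rcases hij with h | h
  · simp [secY, hv.left _ h]
  · rw [if_neg h]

theorem VanishesOff.add {N : ℕ} {v w : GridFun} (hv : VanishesOff N v) (hw : VanishesOff N w) :
    VanishesOff N (v + w) := fun i j h => by simp [hv i j h, hw i j h]

theorem VanishesOff.sub {N : ℕ} {v w : GridFun} (hv : VanishesOff N v) (hw : VanishesOff N w) :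
    VanishesOff N (v - w) := fun i j h => by simp [hv i j h, hw i j h]

theorem VanishesOff.smul {N : ℕ} {v : GridFun} (c : ℝ) (hv : VanishesOff N v) :
    VanishesOff N (c • v) := fun i j h => by simp [hv i j h]

/-- The cut-off version of `h² F_h`. -/
noncomputable def truncF (N : ℕ) : Module.End ℝ GridFun :=
  truncX N + truncY N - (1 / 6 : ℝ) • (truncX N * truncY N)

/-- The cut-off version of `R_h`. -/
noncomputable def truncR (N : ℕ) : Module.End ℝ GridFun :=
  1 - (1 / 12 : ℝ) • (truncX N + truncY N)

/-- The cut-off version of `I_h - c h² Δ_h`. -/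
noncomputable def truncW (N : ℕ) (c : ℝ) : Module.End ℝ GridFun :=
  1 + c • (truncX N + truncY N)

theorem truncF_vanishesOff {N : ℕ} {v : GridFun} (hv : VanishesOff N v) :
    VanishesOff N (truncF N v) :=
  ((truncX_vanishesOff hv).add (truncY_vanishesOff hv)).sub
    ((truncX_vanishesOff (truncY_vanishesOff hv)).smul _)

theorem truncR_vanishesOff {N : ℕ} {v : GridFun} (hv : VanishesOff N v) :
    VanishesOff N (truncR N v) :=
  hv.sub (((truncX_vanishesOff hv).add (truncY_vanishesOff hv)).smul _)

theorem truncW_vanishesOff {N : ℕ} (c : ℝ) {v : GridFun} (hv : VanishesOff N v) :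
    VanishesOff N (truncW N c v) :=
  hv.add (((truncX_vanishesOff hv).add (truncY_vanishesOff hv)).smul _)

theorem commute_truncX_add_truncF (N : ℕ) : Commute (truncX N + truncY N) (truncF N) := by
  have h := commute_truncX_truncY N
  have h1 : Commute (truncX N) (truncF N) :=
    ((Commute.refl _).add_right h).sub_right
      ((((Commute.refl (truncX N)).mul_right h)).smul_right _)
  have h2 : Commute (truncY N) (truncF N) :=
    (h.symm.add_right (Commute.refl _)).sub_right
      (((h.symm.mul_right (Commute.refl (truncY N)))).smul_right _)
  exact h1.add_left h2

theorem commute_truncW_truncF (N : ℕ) (c : ℝ) : Commute (truncW N c) (truncF N) :=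
  (Commute.one_left _).add_left ((commute_truncX_add_truncF N).smul_left c)

theorem commute_truncR_truncF (N : ℕ) : Commute (truncR N) (truncF N) :=
  (Commute.one_left _).sub_left ((commute_truncX_add_truncF N).smul_left _)

theorem commute_truncW_truncR (N : ℕ) (c : ℝ) : Commute (truncW N c) (truncR N) :=
  ((Commute.one_right _).sub_right (((Commute.one_left _).add_left
    ((Commute.refl _).smul_left c)).smul_right _))

theorem truncX_add_truncY_eq_secL {N : ℕ} (v : GridFun) {i j : ℤ}
    (hij : (i, j) ∈ interiorIdx N) : (truncX N + truncY N) v i j = secL v i j := by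
  rw [mem_interiorIdx] at hij
  change truncX N v i j + truncY N v i j = _
  rw [truncX_apply, truncY_apply, if_pos hij.1, if_pos hij.2, secL]

theorem truncF_eq_opF {N : ℕ} (v : GridFun) {i j : ℤ}
    (hij : (i, j) ∈ interiorIdx N) :
    truncF N v i j = (1 / (N : ℝ)) ^ 2 * opF (1 / N) v i j := by
  have hij' := hij
  rw [mem_interiorIdx] at hij'
  have hN : (N : ℝ) ≠ 0 := by
    have : (0 : ℤ) < N := by omega
    exact_mod_cast this.ne'
  have h1 := truncX_add_truncY_eq_secL v hij
  have h2 : truncX N (truncY N v) i j = secX (secY v) i j := by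
    rw [truncX_apply, if_pos hij'.1]
    simp only [secX, truncY_apply, if_pos hij'.2]
  change (truncX N + truncY N) v i j - 1 / 6 * truncX N (truncY N v) i j = _
  rw [h1, h2, opF_eq_secF, secF, secL]
  field_simp

theorem truncR_eq_opR {N : ℕ} (v : GridFun) {i j : ℤ}
    (hij : (i, j) ∈ interiorIdx N) : truncR N v i j = opR v i j := by
  change v i j - 1 / 12 * (truncX N + truncY N) v i j = _
  rw [truncX_add_truncY_eq_secL v hij, opR_eq_secL]; ring

theorem truncW_eq_regWeight {N : ℕ} (γ : ℝ) (v : GridFun) {i j : ℤ}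
    (hij : (i, j) ∈ interiorIdx N) :
    truncW N (γ * N ^ 2) v i j = regWeight γ (1 / N) v i j := by
  change v i j + γ * N ^ 2 * (truncX N + truncY N) v i j = _
  rw [truncX_add_truncY_eq_secL v hij]
  have hN : (N : ℝ) ≠ 0 := by
    rw [mem_interiorIdx] at hij
    have : (0 : ℤ) < N := by omega
    exact_mod_cast this.ne'
  simp only [secL, secX, secY, regWeight, discLaplacian]
  field_simp
  ring

/-- Testing with `v` gives `⟨v, v⟩ + c ⟨L v, v⟩ = 0` with both terms nonnegative. -/
theorem truncW_injective {N : ℕ} {c : ℝ} (hc : 0 ≤ c) {v : GridFun} (hv : VanishesOff N v)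
    (h : truncW N c v = 0) : v = 0 := by
  have h1 : gridInner N (truncW N c v) v
      = gridInner N v v + c * gridInner N (secL v) v := by
    rw [← gridInner_smul_left, ← gridInner_add_left]
    refine gridInner_congr_left _ fun i j hij => ?_
    rw [← truncX_add_truncY_eq_secL v hij]; rfl
  have h2 : gridInner N (truncW N c v) v = 0 := by rw [h]; simp [gridInner]
  have h3 := mul_nonneg hc (gridInner_secL_self_nonneg hv)
  have h4 : gridInner N v v = 0 := by linarith [gridInner_self_nonneg N v]
  funext i j
  by_cases hij : (i, j) ∈ interiorIdx N
  · simp only [interiorIdx, Finset.mem_product] at hij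
    unfold gridInner at h4
    rw [Finset.sum_eq_zero_iff_of_nonneg
      fun _ _ => Finset.sum_nonneg fun _ _ => mul_self_nonneg _] at h4
    have h5 := h4 i hij.1
    rw [Finset.sum_eq_zero_iff_of_nonneg fun _ _ => mul_self_nonneg _] at h5
    exact mul_self_eq_zero.1 (h5 j hij.2)
  · exact hv i j hij

/-- Restriction of a grid function to the interior indices, extended by zero. -/
noncomputable def cutoff (N : ℕ) (v : GridFun) : GridFun :=
  fun i j => if (i, j) ∈ interiorIdx N then v i j else 0

theorem cutoff_vanishesOff (N : ℕ) (v : GridFun) : VanishesOff N (cutoff N v) :=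
  fun _ _ h => if_neg h

/-- Homogeneous boundary values at the boundary grid points. -/
def ZeroBdry (N : ℕ) (v : GridFun) : Prop :=
  ∀ i j : ℤ, 0 ≤ i → i ≤ N → 0 ≤ j → j ≤ N → (i, j) ∉ interiorIdx N → v i j = 0

/-- Samples of a function are arbitrary outside the square, but stencils centred at interior points
only reach indices from `0` to `N`. There the cutoff changes nothing. -/
theorem ZeroBdry.cutoff_eq {N : ℕ} {v : GridFun} (hv : ZeroBdry N v) {i j : ℤ}
    (h1 : 0 ≤ i) (h2 : i ≤ N) (h3 : 0 ≤ j) (h4 : j ≤ N) : cutoff N v i j = v i j := by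
  by_cases h : (i, j) ∈ interiorIdx N
  · exact if_pos h
  · rw [hv i j h1 h2 h3 h4 h]; exact if_neg h

theorem ZeroBdry.opF_cutoff {N : ℕ} {v : GridFun} (hv : ZeroBdry N v) (h : ℝ) {i j : ℤ}
    (hij : (i, j) ∈ interiorIdx N) : opF h (cutoff N v) i j = opF h v i j := by
  rw [mem_interiorIdx] at hij
  unfold opF
  repeat rw [hv.cutoff_eq (by omega) (by omega) (by omega) (by omega)]

theorem ZeroBdry.opR_cutoff {N : ℕ} {v : GridFun} (hv : ZeroBdry N v) {i j : ℤ}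
    (hij : (i, j) ∈ interiorIdx N) : opR (cutoff N v) i j = opR v i j := by
  rw [mem_interiorIdx] at hij
  unfold opR
  repeat rw [hv.cutoff_eq (by omega) (by omega) (by omega) (by omega)]

theorem ZeroBdry.regWeight_cutoff {N : ℕ} {v : GridFun} (hv : ZeroBdry N v) (γ h : ℝ)
    {i j : ℤ} (hij : (i, j) ∈ interiorIdx N) :
    regWeight γ h (cutoff N v) i j = regWeight γ h v i j := by
  rw [mem_interiorIdx] at hij
  unfold regWeight discLaplacian
  repeat rw [hv.cutoff_eq (by omega) (by omega) (by omega) (by omega)]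

/-- The weight `I_h - γ Δ_h` commutes with the other operators and is injective, so that it
drops out of the discrete optimality system. -/
theorem IsDO4TrapRegSolution.control_eq {α γ : ℝ} (hγ : 0 ≤ γ) {N : ℕ} {f g z u p : GridFun}
    (hs : IsDO4TrapRegSolution α γ N f g z u p) (hg : ZeroBdry N g) {i j : ℤ}
    (hij : (i, j) ∈ interiorIdx N) :
    α * opF (1 / N) u i j + opR z i j = opR g i j := by
  have hz : VanishesOff N z := hs.z_ext
  have hu : VanishesOff N u := hs.u_ext
  have hp : VanishesOff N p := hs.p_ext
  -- Cutting off `g` puts the right side of the adjoint equation into the space where the truncated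
  -- operators represent the stencils.
  set q := cutoff N g - z with hq
  have hqv : VanishesOff N q := (cutoff_vanishesOff N g).sub hz
  set c : ℝ := γ * N ^ 2 with hc
  set s : ℝ := (1 / (N : ℝ)) ^ 2 with hs'
  have hN : (N : ℝ) ≠ 0 := by
    rw [mem_interiorIdx] at hij
    have : (0 : ℤ) < N := by omega
    exact_mod_cast this.ne'
  have e1 : truncF N p = s • truncW N c q := by
    funext k l
    by_cases h : (k, l) ∈ interiorIdx N
    · have e : regWeight γ (1 / N) q k l
          = regWeight γ (1 / N) g k l - regWeight γ (1 / N) z k l := by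
        rw [hq, regWeight_sub, Pi.sub_apply, Pi.sub_apply, hg.regWeight_cutoff _ _ h]
      rw [truncF_eq_opF _ h, Pi.smul_apply, Pi.smul_apply, truncW_eq_regWeight _ _ h, e,
        ← hs.adjoint k l h, smul_eq_mul]
      ring
    · rw [truncF_vanishesOff hp k l h, ((truncW_vanishesOff c hqv).smul s) k l h]
  have e2 : α • truncW N c u = truncR N p := by
    funext k l
    by_cases h : (k, l) ∈ interiorIdx N
    · rw [truncR_eq_opR _ h, Pi.smul_apply, Pi.smul_apply, truncW_eq_regWeight _ _ h,
        smul_eq_mul]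
      linarith [hs.gradient k l h]
    · rw [truncR_vanishesOff hp k l h, ((truncW_vanishesOff c hu).smul α) k l h]
  -- `W (α F u) = F (α W u) = F R p = R F p = s R W q = W (s R q)`, using that all three operators
  -- commute.
  have e3 : truncW N c (α • truncF N u - s • truncR N q) = 0 := by
    have a1 : truncW N c (truncF N u) = truncF N (truncW N c u) :=
      LinearMap.congr_fun (commute_truncW_truncF N c).eq u
    have a2 : truncR N (truncF N p) = truncF N (truncR N p) :=
      LinearMap.congr_fun (commute_truncR_truncF N).eq p
    have a3 : truncW N c (truncR N q) = truncR N (truncW N c q) :=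
      LinearMap.congr_fun (commute_truncW_truncR N c).eq q
    rw [map_sub, map_smul, map_smul, a1, a3, ← map_smul (truncF N), e2, ← a2, e1, map_smul,
      sub_self]
  have e4 := truncW_injective (by positivity)
    (((truncF_vanishesOff hu).smul α).sub ((truncR_vanishesOff hqv).smul s)) e3
  have e5 := congrFun (congrFun e4 i) j
  simp only [Pi.sub_apply, Pi.smul_apply, smul_eq_mul, Pi.zero_apply] at e5
  have e6 : opR q i j = opR g i j - opR z i j := by
    rw [hq, opR_sub, Pi.sub_apply, Pi.sub_apply, hg.opR_cutoff hij]
  rw [truncF_eq_opF _ hij, truncR_eq_opR _ hij, e6] at e5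
  have hs0 : s ≠ 0 := by positivity
  have : s * (α * opF (1 / N) u i j - (opR g i j - opR z i j)) = 0 := by linarith
  have := (mul_eq_zero.1 this).resolve_left hs0
  linarith

/-! ### Unique solvability of the discrete system -/

/-- Stability with `τ = 0` kills the state and the control; the adjoint equation then reads `F_h p =
0`, and `F_h` is injective. -/
theorem IsDO4TrapRegSolution.eq_zero {α γ : ℝ} (hα : 0 < α) (hγ : 0 ≤ γ) {N : ℕ} (hN : 1 ≤ N)
    {z u p : GridFun} (hs : IsDO4TrapRegSolution α γ N 0 0 z u p) : z = 0 ∧ u = 0 ∧ p = 0 := by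
  have h0 : opR 0 = 0 := opRLin.map_zero
  have hW0 : ∀ h, regWeight γ h 0 = 0 := fun h => (regWeightLin γ h).map_zero
  have key := coupled_stability hα hN hs.z_ext hs.u_ext le_rfl
    (fun i j h => by rw [hs.state i j h, h0]; simp)
    (fun i j h => by rw [hs.control_eq hγ (fun _ _ _ _ _ _ _ => rfl) h, h0]; simp)
  simp only [mul_zero, abs_nonpos_iff] at key
  have hz : z = 0 := by funext i j; exact (key i j).1
  have hu : u = 0 := by funext i j; exact (key i j).2
  refine ⟨hz, hu, eq_zero_of_opF_eq_zero hN hs.p_ext fun i j h => ?_⟩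
  have := hs.adjoint i j h
  simpa [hz, hW0] using this

theorem IsDO4TrapRegSolution.sub {α γ : ℝ} {N : ℕ} {f g z u p z' u' p' : GridFun}
    (hs : IsDO4TrapRegSolution α γ N f g z u p)
    (hs' : IsDO4TrapRegSolution α γ N f g z' u' p') :
    IsDO4TrapRegSolution α γ N 0 0 (z - z') (u - u') (p - p') where
  z_ext := VanishesOff.sub hs.z_ext hs'.z_ext
  u_ext := VanishesOff.sub hs.u_ext hs'.u_ext
  p_ext := VanishesOff.sub hs.p_ext hs'.p_ext
  state i j h := by
    have h0 : opR 0 = 0 := opRLin.map_zero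
    rw [opF_sub, opR_sub, h0]
    simp only [Pi.sub_apply, Pi.zero_apply]
    linarith [hs.state i j h, hs'.state i j h]
  adjoint i j h := by
    have h0 : regWeight γ (1 / N) 0 = 0 := (regWeightLin γ (1 / N)).map_zero
    rw [opF_sub, regWeight_sub, h0]
    simp only [Pi.sub_apply, Pi.zero_apply]
    linarith [hs.adjoint i j h, hs'.adjoint i j h]
  gradient i j h := by
    rw [regWeight_sub, opR_sub]
    simp only [Pi.sub_apply]
    linarith [hs.gradient i j h, hs'.gradient i j h]

/-- Extension by zero of a function on the interior indices. -/
noncomputable def extendZero (N : ℕ) : (interiorIdx N → ℝ) →ₗ[ℝ] GridFun where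
  toFun x := fun i j => if h : (i, j) ∈ interiorIdx N then x ⟨(i, j), h⟩ else 0
  map_add' x y := by funext i j; simp only [Pi.add_apply]; split_ifs <;> simp
  map_smul' c x := by
    funext i j; simp only [Pi.smul_apply, smul_eq_mul, RingHom.id_apply]; split_ifs <;> simp

theorem extendZero_vanishesOff {N : ℕ} (x : interiorIdx N → ℝ) :
    VanishesOff N (extendZero N x) := fun _ _ h => dif_neg h

theorem extendZero_eq_zero {N : ℕ} {x : interiorIdx N → ℝ} (h : extendZero N x = 0) : x = 0 := by
  funext k
  have := congrFun (congrFun h k.1.1) k.1.2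
  exact (dif_pos k.2).symm.trans this

/-- Restriction to the interior indices. -/
noncomputable def restrict (N : ℕ) : GridFun →ₗ[ℝ] (interiorIdx N → ℝ) where
  toFun v := fun k => v k.1.1 k.1.2
  map_add' _ _ := rfl
  map_smul' _ _ := rfl

/-- The matrix of the discrete optimality system. -/
noncomputable def systemMap (α γ : ℝ) (N : ℕ) :
    Module.End ℝ ((interiorIdx N → ℝ) × (interiorIdx N → ℝ) × (interiorIdx N → ℝ)) :=
  let E := extendZero N
  let z := E ∘ₗ LinearMap.fst ℝ _ _
  let u := E ∘ₗ LinearMap.fst ℝ _ _ ∘ₗ LinearMap.snd ℝ _ _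
  let p := E ∘ₗ LinearMap.snd ℝ _ _ ∘ₗ LinearMap.snd ℝ _ _
  (restrict N ∘ₗ (opFLin (1 / N) ∘ₗ z - opRLin ∘ₗ u)).prod
    ((restrict N ∘ₗ (opFLin (1 / N) ∘ₗ p + regWeightLin γ (1 / N) ∘ₗ z)).prod
      (restrict N ∘ₗ (α • regWeightLin γ (1 / N) ∘ₗ u - opRLin ∘ₗ p)))

theorem systemMap_apply (α γ : ℝ) (N : ℕ) (x y w : interiorIdx N → ℝ) :
    systemMap α γ N (x, y, w) =
      (restrict N (opF (1 / N) (extendZero N x) - opR (extendZero N y)),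
        restrict N (opF (1 / N) (extendZero N w) + regWeight γ (1 / N) (extendZero N x)),
        restrict N (α • regWeight γ (1 / N) (extendZero N y) - opR (extendZero N w))) := rfl

theorem systemMap_eq_iff {α γ : ℝ} {N : ℕ} {f g : GridFun} (x y w : interiorIdx N → ℝ) :
    systemMap α γ N (x, y, w) = (restrict N (opR f), restrict N (regWeight γ (1 / N) g), 0) ↔
      IsDO4TrapRegSolution α γ N f g (extendZero N x) (extendZero N y) (extendZero N w) := by
  rw [systemMap_apply, Prod.mk.injEq, Prod.mk.injEq]
  constructor
  · rintro ⟨h1, h2, h3⟩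
    exact ⟨extendZero_vanishesOff x, extendZero_vanishesOff y, extendZero_vanishesOff w,
      fun i j hij => congrFun h1 ⟨(i, j), hij⟩, fun i j hij => congrFun h2 ⟨(i, j), hij⟩,
      fun i j hij => congrFun h3 ⟨(i, j), hij⟩⟩
  · intro h
    refine ⟨?_, ?_, ?_⟩
    · funext k; exact h.state _ _ k.2
    · funext k; exact h.adjoint _ _ k.2
    · funext k; exact h.gradient _ _ k.2

theorem existsUnique_isDO4TrapRegSolution {α γ : ℝ} (hα : 0 < α) (hγ : 0 ≤ γ) {N : ℕ}
    (hN : 1 ≤ N) (f g : GridFun) :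
    ∃! s : GridFun × GridFun × GridFun, IsDO4TrapRegSolution α γ N f g s.1 s.2.1 s.2.2 := by
  have hinj : Function.Injective (systemMap α γ N) := by
    rw [injective_iff_map_eq_zero]
    rintro ⟨x, y, w⟩ h
    have h' : systemMap α γ N (x, y, w)
        = (restrict N (opR 0), restrict N (regWeight γ (1 / N) 0), 0) := by
      have h0 : opR 0 = 0 := opRLin.map_zero
      have h1 : regWeight γ (1 / N) 0 = 0 := (regWeightLin γ (1 / N)).map_zero
      rw [h, h0, h1, map_zero]; rfl
    obtain ⟨h1, h2, h3⟩ := ((systemMap_eq_iff x y w).1 h').eq_zero hα hγ hN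
    rw [extendZero_eq_zero h1, extendZero_eq_zero h2, extendZero_eq_zero h3]; rfl
  -- An injective endomorphism of a finite-dimensional space is surjective.
  obtain ⟨⟨x, y, w⟩, hx⟩ := LinearMap.injective_iff_surjective.1 hinj
    (restrict N (opR f), restrict N (regWeight γ (1 / N) g), 0)
  have hs := (systemMap_eq_iff x y w).1 hx
  refine ⟨(extendZero N x, extendZero N y, extendZero N w), hs, ?_⟩
  rintro ⟨z', u', p'⟩ hs'
  obtain ⟨h1, h2, h3⟩ := (hs'.sub hs).eq_zero hα hγ hN
  rw [sub_eq_zero] at h1 h2 h3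
  dsimp only at h1 h2 h3
  rw [h1, h2, h3]

end EllipticControl

namespace EllipticControl

/-! ### Symmetric Taylor estimates -/

/-- Mean value theorem. Derivatives are asked for in the open interval only, since a stencil may
touch the boundary of the square. -/
theorem abs_le_of_hasDerivAt_bound {f f' : ℝ → ℝ} {h M : ℝ}
    (hc : ContinuousOn f (Set.Icc 0 h)) (h0 : f 0 = 0)
    (hd : ∀ t ∈ Set.Ioo 0 h, HasDerivAt f (f' t) t) (hM : ∀ t ∈ Set.Ioo 0 h, |f' t| ≤ M)
    (hM0 : 0 ≤ M) {t : ℝ} (ht : t ∈ Set.Icc 0 h) : |f t| ≤ M * h := by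
  rcases ht.1.eq_or_lt with rfl | h1
  · rw [h0, abs_zero]; exact mul_nonneg hM0 ht.2
  obtain ⟨c, hc', e⟩ := exists_hasDerivAt_eq_slope f f' h1
    (hc.mono (Set.Icc_subset_Icc_right ht.2))
    (fun x hx => hd x ⟨hx.1, hx.2.trans_le ht.2⟩)
  have e' : f t = f' c * t := by
    rw [e, h0]; field_simp; ring
  rw [e', abs_mul, abs_of_pos h1]
  exact mul_le_mul (hM c ⟨hc'.1, hc'.2.trans_le ht.2⟩) ht.2 h1.le hM0

theorem abs_le_of_secondDeriv_bound {f f' f'' : ℝ → ℝ} {h M : ℝ}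
    (hc : ContinuousOn f (Set.Icc 0 h)) (hc' : ContinuousOn f' (Set.Icc 0 h))
    (h0 : f 0 = 0) (h0' : f' 0 = 0)
    (hd : ∀ t ∈ Set.Ioo 0 h, HasDerivAt f (f' t) t)
    (hd' : ∀ t ∈ Set.Ioo 0 h, HasDerivAt f' (f'' t) t)
    (hM : ∀ t ∈ Set.Ioo 0 h, |f'' t| ≤ M)
    (hM0 : 0 ≤ M) {t : ℝ} (ht : t ∈ Set.Icc 0 h) : |f t| ≤ M * h ^ 2 := by
  have hh : 0 ≤ h := ht.1.trans ht.2
  have := abs_le_of_hasDerivAt_bound hc h0 hd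
    (fun t ht => abs_le_of_hasDerivAt_bound hc' h0' hd' hM hM0 (Set.Ioo_subset_Icc_self ht))
    (by positivity) ht
  rwa [sq, ← mul_assoc]

/-- `φ 0, …, φ n` are continuous on `[a, b]`, and each is the derivative of its predecessor
on `(a, b)`. -/
structure IsDerivChain (φ : ℕ → ℝ → ℝ) (n : ℕ) (a b : ℝ) : Prop where
  cont : ∀ k ≤ n, ContinuousOn (φ k) (Set.Icc a b)
  deriv : ∀ k < n, ∀ s ∈ Set.Ioo a b, HasDerivAt (φ k) (φ (k + 1) s) s

theorem IsDerivChain.shift_two {φ : ℕ → ℝ → ℝ} {n : ℕ} {a b : ℝ}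
    (H : IsDerivChain φ (n + 2) a b) : IsDerivChain (fun k => φ (k + 2)) n a b :=
  ⟨fun k hk => H.cont (k + 2) (by omega), fun k hk s hs => H.deriv (k + 2) (by omega) s hs⟩

section Symmetric

variable {φ : ℕ → ℝ → ℝ} {n : ℕ} {x h : ℝ}

theorem IsDerivChain.continuousOn_add (H : IsDerivChain φ n (x - h) (x + h)) {k : ℕ}
    (hk : k ≤ n) : ContinuousOn (fun t => φ k (x + t)) (Set.Icc 0 h) :=
  (H.cont k hk).comp (by fun_prop) fun t ht => ⟨by linarith [ht.1, ht.2], by linarith [ht.2]⟩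

theorem IsDerivChain.continuousOn_sub (H : IsDerivChain φ n (x - h) (x + h)) {k : ℕ}
    (hk : k ≤ n) : ContinuousOn (fun t => φ k (x - t)) (Set.Icc 0 h) :=
  (H.cont k hk).comp (by fun_prop) fun t ht => ⟨by linarith [ht.2], by linarith [ht.1, ht.2]⟩

theorem IsDerivChain.hasDerivAt_add (H : IsDerivChain φ n (x - h) (x + h)) {k : ℕ} (hk : k < n)
    {t : ℝ} (ht : t ∈ Set.Ioo 0 h) :
    HasDerivAt (fun t => φ k (x + t)) (φ (k + 1) (x + t)) t :=
  HasDerivAt.comp_const_add x t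
    (H.deriv k hk (x + t) ⟨by linarith [ht.1, ht.2], by linarith [ht.2]⟩)

theorem IsDerivChain.hasDerivAt_sub (H : IsDerivChain φ n (x - h) (x + h)) {k : ℕ} (hk : k < n)
    {t : ℝ} (ht : t ∈ Set.Ioo 0 h) :
    HasDerivAt (fun t => φ k (x - t)) (-φ (k + 1) (x - t)) t :=
  HasDerivAt.comp_const_sub x t
    (H.deriv k hk (x - t) ⟨by linarith [ht.2], by linarith [ht.1, ht.2]⟩)

theorem abs_add_le_two_mul {φ : ℝ → ℝ} {x h M : ℝ}
    (hM : ∀ s ∈ Set.Icc (x - h) (x + h), |φ s| ≤ M) {t : ℝ} (ht : t ∈ Set.Icc 0 h) :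
    |φ (x + t) + φ (x - t)| ≤ 2 * M := by
  have h1 := hM (x + t) ⟨by linarith [ht.1, ht.2], by linarith [ht.2]⟩
  have h2 := hM (x - t) ⟨by linarith [ht.2], by linarith [ht.1, ht.2]⟩
  linarith [abs_add_le (φ (x + t)) (φ (x - t))]

/-- As a function of `t`, the symmetric difference vanishes at `0` together with its derivative. The
next two lemmas bootstrap: the second `t`-derivative of a remainder for `φ` is the remainder of
order two lower for `φ''`. Constants are not sharp. -/
theorem IsDerivChain.abs_secondDiff_le {M : ℝ} (H : IsDerivChain φ 2 (x - h) (x + h))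
    (hM0 : 0 ≤ M) (hM : ∀ s ∈ Set.Icc (x - h) (x + h), |φ 2 s| ≤ M) {t : ℝ}
    (ht : t ∈ Set.Icc 0 h) :
    |φ 0 (x + t) + φ 0 (x - t) - 2 * φ 0 x| ≤ 2 * M * h ^ 2 := by
  refine abs_le_of_secondDeriv_bound
    (f := fun t => φ 0 (x + t) + φ 0 (x - t) - 2 * φ 0 x)
    (f' := fun t => φ 1 (x + t) - φ 1 (x - t))
    (f'' := fun t => φ 2 (x + t) + φ 2 (x - t)) ?_ ?_ ?_ ?_ ?_ ?_ ?_ (by positivity) ht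
  · exact ((H.continuousOn_add (by norm_num)).add (H.continuousOn_sub (by norm_num))).sub
      continuousOn_const
  · exact (H.continuousOn_add (by norm_num)).sub (H.continuousOn_sub (by norm_num))
  · simp; ring
  · simp
  · intro t ht
    refine HasDerivAt.congr_deriv (((H.hasDerivAt_add (k := 0) (by norm_num) ht).add
      (H.hasDerivAt_sub (k := 0) (by norm_num) ht)).sub_const (2 * φ 0 x)) ?_
    ring
  · intro t ht
    refine HasDerivAt.congr_deriv ((H.hasDerivAt_add (k := 1) (by norm_num) ht).sub
      (H.hasDerivAt_sub (k := 1) (by norm_num) ht)) ?_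
    ring
  · intro t ht
    exact abs_add_le_two_mul hM (Set.Ioo_subset_Icc_self ht)

theorem IsDerivChain.abs_secondDiff_sub_le {M : ℝ} (H : IsDerivChain φ 4 (x - h) (x + h))
    (hM0 : 0 ≤ M) (hM : ∀ s ∈ Set.Icc (x - h) (x + h), |φ 4 s| ≤ M) {t : ℝ}
    (ht : t ∈ Set.Icc 0 h) :
    |φ 0 (x + t) + φ 0 (x - t) - 2 * φ 0 x - t ^ 2 * φ 2 x| ≤ 2 * M * h ^ 4 := by
  have key := abs_le_of_secondDeriv_bound (h := h) (M := 2 * M * h ^ 2)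
    (f := fun t => φ 0 (x + t) + φ 0 (x - t) - 2 * φ 0 x - t ^ 2 * φ 2 x)
    (f' := fun t => φ 1 (x + t) - φ 1 (x - t) - 2 * t * φ 2 x)
    (f'' := fun t => φ 2 (x + t) + φ 2 (x - t) - 2 * φ 2 x)
    ?_ ?_ ?_ ?_ ?_ ?_ ?_ (by positivity) ht
  · exact key.trans (le_of_eq (by ring))
  · exact (((H.continuousOn_add (by norm_num)).add (H.continuousOn_sub (by norm_num))).sub
      continuousOn_const).sub (by fun_prop)
  · exact ((H.continuousOn_add (by norm_num)).sub (H.continuousOn_sub (by norm_num))).sub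
      (by fun_prop)
  · simp; ring
  · simp
  · intro t ht
    refine HasDerivAt.congr_deriv ((((H.hasDerivAt_add (k := 0) (by norm_num) ht).add
      (H.hasDerivAt_sub (k := 0) (by norm_num) ht)).sub_const (2 * φ 0 x)).sub
      ((hasDerivAt_pow 2 t).mul_const (φ 2 x))) ?_
    norm_num
    ring
  · intro t ht
    refine HasDerivAt.congr_deriv (((H.hasDerivAt_add (k := 1) (by norm_num) ht).sub
      (H.hasDerivAt_sub (k := 1) (by norm_num) ht)).sub
      (((hasDerivAt_id t).const_mul 2).mul_const (φ 2 x))) ?_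
    ring
  · intro t ht
    exact H.shift_two.abs_secondDiff_le hM0 hM (Set.Ioo_subset_Icc_self ht)

theorem IsDerivChain.abs_secondDiff_sub_sub_le {M : ℝ} (H : IsDerivChain φ 6 (x - h) (x + h))
    (hM0 : 0 ≤ M) (hM : ∀ s ∈ Set.Icc (x - h) (x + h), |φ 6 s| ≤ M) {t : ℝ}
    (ht : t ∈ Set.Icc 0 h) :
    |φ 0 (x + t) + φ 0 (x - t) - 2 * φ 0 x - t ^ 2 * φ 2 x - t ^ 4 * (φ 4 x / 12)|
      ≤ 2 * M * h ^ 6 := by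
  have key := abs_le_of_secondDeriv_bound (h := h) (M := 2 * M * h ^ 4)
    (f := fun t => φ 0 (x + t) + φ 0 (x - t) - 2 * φ 0 x - t ^ 2 * φ 2 x - t ^ 4 * (φ 4 x / 12))
    (f' := fun t => φ 1 (x + t) - φ 1 (x - t) - 2 * t * φ 2 x - t ^ 3 * (φ 4 x / 3))
    (f'' := fun t => φ 2 (x + t) + φ 2 (x - t) - 2 * φ 2 x - t ^ 2 * φ 4 x)
    ?_ ?_ ?_ ?_ ?_ ?_ ?_ (by positivity) ht
  · exact key.trans (le_of_eq (by ring))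
  · exact ((((H.continuousOn_add (by norm_num)).add (H.continuousOn_sub (by norm_num))).sub
      continuousOn_const).sub (by fun_prop)).sub (by fun_prop)
  · exact (((H.continuousOn_add (by norm_num)).sub (H.continuousOn_sub (by norm_num))).sub
      (by fun_prop)).sub (by fun_prop)
  · simp; ring
  · simp
  · intro t ht
    refine HasDerivAt.congr_deriv (((((H.hasDerivAt_add (k := 0) (by norm_num) ht).add
      (H.hasDerivAt_sub (k := 0) (by norm_num) ht)).sub_const (2 * φ 0 x)).sub
      ((hasDerivAt_pow 2 t).mul_const (φ 2 x))).sub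
      ((hasDerivAt_pow 4 t).mul_const (φ 4 x / 12))) ?_
    norm_num
    ring
  · intro t ht
    refine HasDerivAt.congr_deriv ((((H.hasDerivAt_add (k := 1) (by norm_num) ht).sub
      (H.hasDerivAt_sub (k := 1) (by norm_num) ht)).sub
      (((hasDerivAt_id t).const_mul 2).mul_const (φ 2 x))).sub
      ((hasDerivAt_pow 3 t).mul_const (φ 4 x / 3))) ?_
    norm_num
    ring
  · intro t ht
    exact H.shift_two.abs_secondDiff_sub_le hM0 hM (Set.Ioo_subset_Icc_self ht)

/-- The term `h⁴ φ⁗(x) / 12` of the second difference of `φ` is matched by `h² / 12` times the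
second difference of `φ''`, leaving order `h⁶`. -/
theorem IsDerivChain.numerov {M : ℝ} (H : IsDerivChain φ 6 (x - h) (x + h)) (hh : 0 ≤ h)
    (hM0 : 0 ≤ M) (hM : ∀ s ∈ Set.Icc (x - h) (x + h), |φ 6 s| ≤ M) :
    |φ 0 (x + h) + φ 0 (x - h) - 2 * φ 0 x
      - h ^ 2 / 12 * (φ 2 (x + h) + φ 2 (x - h) + 10 * φ 2 x)| ≤ 3 * M * h ^ 6 := by
  have h1 := H.abs_secondDiff_sub_sub_le hM0 hM (Set.right_mem_Icc.2 hh)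
  have h2 := H.shift_two.abs_secondDiff_sub_le hM0 hM (Set.right_mem_Icc.2 hh)
  simp only [zero_add, Nat.reduceAdd] at h2
  have h3 : |h ^ 2 / 12 * (φ 2 (x + h) + φ 2 (x - h) - 2 * φ 2 x - h ^ 2 * φ 4 x)|
      ≤ h ^ 2 / 12 * (2 * M * h ^ 4) := by
    rw [abs_mul, abs_of_nonneg (by positivity : 0 ≤ h ^ 2 / 12)]
    gcongr
  have h4 := abs_sub (φ 0 (x + h) + φ 0 (x - h) - 2 * φ 0 x - h ^ 2 * φ 2 x
    - h ^ 4 * (φ 4 x / 12))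
    (h ^ 2 / 12 * (φ 2 (x + h) + φ 2 (x - h) - 2 * φ 2 x - h ^ 2 * φ 4 x))
  have h5 : 0 ≤ M * h ^ 6 := by positivity
  calc _ = |φ 0 (x + h) + φ 0 (x - h) - 2 * φ 0 x - h ^ 2 * φ 2 x - h ^ 4 * (φ 4 x / 12)
        - h ^ 2 / 12 * (φ 2 (x + h) + φ 2 (x - h) - 2 * φ 2 x - h ^ 2 * φ 4 x)| := by
        congr 1; ring
    _ ≤ 3 * M * h ^ 6 := by linarith

end Symmetric

/-! ### Consistency of the compact scheme -/

/-- `D a b` plays the role of `∂ₓᵃ ∂ᵧᵇ w` on the closed unit square for `a + b ≤ 6`. -/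
structure IsDerivTable (D : ℕ → ℕ → ℝ → ℝ → ℝ) (M : ℝ) : Prop where
  chain_x : ∀ a b n, a + b + n ≤ 6 → ∀ y ∈ Set.Icc (0 : ℝ) 1,
    IsDerivChain (fun k x => D (a + k) b x y) n 0 1
  chain_y : ∀ a b n, a + b + n ≤ 6 → ∀ x ∈ Set.Icc (0 : ℝ) 1,
    IsDerivChain (fun k y => D a (b + k) x y) n 0 1
  bound : ∀ a b, a + b ≤ 6 → ∀ x ∈ Set.Icc (0 : ℝ) 1, ∀ y ∈ Set.Icc (0 : ℝ) 1, |D a b x y| ≤ M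

theorem IsDerivChain.mono {φ : ℕ → ℝ → ℝ} {n : ℕ} {a b a' b' : ℝ} (H : IsDerivChain φ n a b)
    (ha : a ≤ a') (hb : b' ≤ b) : IsDerivChain φ n a' b' :=
  ⟨fun k hk => (H.cont k hk).mono (Set.Icc_subset_Icc ha hb),
    fun k hk s hs => H.deriv k hk s (Set.Ioo_subset_Ioo ha hb hs)⟩

theorem IsDerivTable.swap {D : ℕ → ℕ → ℝ → ℝ → ℝ} {M : ℝ} (H : IsDerivTable D M) :
    IsDerivTable (fun a b x y => D b a y x) M where
  chain_x a b n h y hy := H.chain_y b a n (by omega) y hy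
  chain_y a b n h x hx := H.chain_x b a n (by omega) x hx
  bound a b h x hx y hy := H.bound b a (by omega) y hy x hx

/-- The second difference in `y` of the consistency error of the second difference in `x`. -/
theorem IsDerivTable.abs_mixed_le {D : ℕ → ℕ → ℝ → ℝ → ℝ} {M : ℝ} (H : IsDerivTable D M)
    {x y h : ℝ} (hh : 0 ≤ h) (hM : 0 ≤ M) (hx0 : 0 ≤ x - h) (hx1 : x + h ≤ 1)
    (hy0 : 0 ≤ y - h) (hy1 : y + h ≤ 1) :
    let G := fun y => D 0 0 (x + h) y + D 0 0 (x - h) y - 2 * D 0 0 x y - h ^ 2 * D 2 0 x y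
    |G (y + h) + G (y - h) - 2 * G y| ≤ 4 * M * h ^ 6 := by
  intro G
  have m1 : x + h ∈ Set.Icc (0 : ℝ) 1 := ⟨by linarith, hx1⟩
  have m2 : x - h ∈ Set.Icc (0 : ℝ) 1 := ⟨hx0, by linarith⟩
  have m3 : x ∈ Set.Icc (0 : ℝ) 1 := ⟨by linarith, by linarith⟩
  set Φ : ℕ → ℝ → ℝ := fun k y => D 0 k (x + h) y + D 0 k (x - h) y - 2 * D 0 k x y
    - h ^ 2 * D 2 k x y with hΦ
  have hchain : IsDerivChain Φ 2 (y - h) (y + h) := by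
    have c1 := (H.chain_y 0 0 2 (by norm_num) _ m1).mono hy0 hy1
    have c2 := (H.chain_y 0 0 2 (by norm_num) _ m2).mono hy0 hy1
    have c3 := (H.chain_y 0 0 2 (by norm_num) _ m3).mono hy0 hy1
    have c4 := (H.chain_y 2 0 2 (by norm_num) _ m3).mono hy0 hy1
    simp only [zero_add] at c1 c2 c3 c4
    refine ⟨fun k hk => ?_, fun k hk s hs => ?_⟩
    · exact (((c1.cont k hk).add (c2.cont k hk)).sub ((c3.cont k hk).const_mul 2)).sub
        ((c4.cont k hk).const_mul (h ^ 2))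
    · exact (((c1.deriv k hk s hs).add (c2.deriv k hk s hs)).sub
        ((c3.deriv k hk s hs).const_mul 2)).sub ((c4.deriv k hk s hs).const_mul (h ^ 2))
  -- `Φ 2` is the fourth-order `x`-remainder of `∂ᵧ² w`, so it is controlled by `∂ₓ⁴ ∂ᵧ² w`.
  have hb : ∀ s ∈ Set.Icc (y - h) (y + h), |Φ 2 s| ≤ 2 * M * h ^ 4 := by
    intro s hs
    have hs' : s ∈ Set.Icc (0 : ℝ) 1 := ⟨by linarith [hs.1], by linarith [hs.2]⟩
    have c := (H.chain_x 0 2 4 (by norm_num) s hs').mono hx0 hx1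
    simp only [zero_add] at c
    exact c.abs_secondDiff_sub_le hM
      (fun r hr => H.bound 4 2 (by norm_num) r ⟨by linarith [hr.1], by linarith [hr.2]⟩ s hs')
      (Set.right_mem_Icc.2 hh)
  have := hchain.abs_secondDiff_le (by positivity) hb (Set.right_mem_Icc.2 hh)
  exact this.trans (le_of_eq (by ring))

/-- The nine-point scheme is consistent of fourth order. -/
theorem IsDerivTable.consistency {D : ℕ → ℕ → ℝ → ℝ → ℝ} {M : ℝ} (H : IsDerivTable D M)
    {x y h : ℝ} (hh : 0 < h) (hM : 0 ≤ M) (hx0 : 0 ≤ x - h) (hx1 : x + h ≤ 1)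
    (hy0 : 0 ≤ y - h) (hy1 : y + h ≤ 1) :
    let w := D 0 0
    let q := fun x y => D 2 0 x y + D 0 2 x y
    |(20 * w x y - 4 * (w (x + h) y + w (x - h) y + w x (y + h) + w x (y - h))
      - (w (x + h) (y + h) + w (x + h) (y - h) + w (x - h) (y + h) + w (x - h) (y - h)))
        / (6 * h ^ 2)
      + (8 * q x y + q (x + h) y + q (x - h) y + q x (y + h) + q x (y - h)) / 12|
      ≤ 7 * M * h ^ 4 := by
  intro w q
  have mx : x ∈ Set.Icc (0 : ℝ) 1 := ⟨by linarith, by linarith⟩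
  have my : y ∈ Set.Icc (0 : ℝ) 1 := ⟨by linarith, by linarith⟩
  have cx := (H.chain_x 0 0 6 (by norm_num) y my).mono hx0 hx1
  have cy := (H.chain_y 0 0 6 (by norm_num) x mx).mono hy0 hy1
  simp only [zero_add] at cx cy
  have nx := cx.numerov hh.le hM
    (fun s hs => H.bound 6 0 (by norm_num) s ⟨by linarith [hs.1], by linarith [hs.2]⟩ y my)
  have ny := cy.numerov hh.le hM
    (fun s hs => H.bound 0 6 (by norm_num) x mx s ⟨by linarith [hs.1], by linarith [hs.2]⟩)
  have gx := H.abs_mixed_le hh.le hM hx0 hx1 hy0 hy1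
  have gy := H.swap.abs_mixed_le hh.le hM hy0 hy1 hx0 hx1
  dsimp only at nx ny gx gy
  have hpos : 0 < h ^ 2 := by positivity
  have hM6 : 0 ≤ M * h ^ 6 := by positivity
  set E := (20 * w x y - 4 * (w (x + h) y + w (x - h) y + w x (y + h) + w x (y - h))
      - (w (x + h) (y + h) + w (x + h) (y - h) + w (x - h) (y + h) + w (x - h) (y - h)))
        / (6 * h ^ 2)
      + (8 * q x y + q (x + h) y + q (x - h) y + q x (y + h) + q x (y - h)) / 12 with hE
  have e : h ^ 2 * E = (20 * w x y - 4 * (w (x + h) y + w (x - h) y + w x (y + h) + w x (y - h))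
      - (w (x + h) (y + h) + w (x + h) (y - h) + w (x - h) (y + h) + w (x - h) (y - h))) / 6
      + h ^ 2 / 12 * (8 * q x y + q (x + h) y + q (x - h) y + q x (y + h) + q x (y - h)) := by
    rw [hE]; field_simp
  -- Exactly, `h² E = -(nx + ny) - (gx + gy) / 12` in terms of the quantities bounded above: `δₓ²
  -- δᵧ² w / 6` is split in halves, paired with `δᵧ² ∂ₓ² w` and `δₓ² ∂ᵧ² w` from `R_h`. The bounds
  -- add up to `3 + 3 + 8 / 12 ≤ 7`.
  have key : |h ^ 2 * E| ≤ h ^ 2 * (7 * M * h ^ 4) := by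
    rw [e]
    simp only [w, q]
    rw [abs_le] at *
    constructor <;> linarith [nx.1, nx.2, ny.1, ny.2, gx.1, gx.2, gy.1, gy.2]
  rw [abs_mul, abs_of_pos hpos] at key
  exact le_of_mul_le_mul_left key hpos

end EllipticControl

namespace EllipticControl

/-! ### Partial derivatives up to the boundary -/

/-- The Euclidean plane. -/
abbrev Plane : Type := EuclideanSpace ℝ (Fin 2)

theorem closure_unitSquare :
    closure unitSquare = {x : Plane | ∀ k, x k ∈ Set.Icc (0 : ℝ) 1} := by
  have h : unitSquare = (EuclideanSpace.equiv (Fin 2) ℝ).toHomeomorph ⁻¹'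
      Set.pi Set.univ fun _ => Set.Ioo (0 : ℝ) 1 := by
    ext x; simp [unitSquare]
  rw [h, ← Homeomorph.preimage_closure, closure_pi_set]
  ext x
  simp only [closure_Ioo (zero_ne_one (α := ℝ)), Set.mem_preimage, Set.mem_univ_pi]
  rfl

theorem isOpen_unitSquare : IsOpen unitSquare := by
  have : unitSquare = ⋂ k : Fin 2, (fun x : Plane => x k) ⁻¹' Set.Ioo (0 : ℝ) 1 := by
    ext x; simp [unitSquare]
  rw [this]
  exact isOpen_iInter_of_finite fun k => isOpen_Ioo.preimage (by fun_prop)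

theorem convex_closure_unitSquare : Convex ℝ (closure unitSquare) := by
  rw [closure_unitSquare]
  intro x hx y hy a b ha hb hab k
  exact (convex_Icc (0 : ℝ) 1) (hx k) (hy k) ha hb hab

theorem unitSquare_nonempty : unitSquare.Nonempty :=
  ⟨!₂[1 / 2, 1 / 2], fun k => by fin_cases k <;> norm_num⟩

theorem unitSquare_subset_interior : unitSquare ⊆ interior (closure unitSquare) :=
  isOpen_unitSquare.subset_interior_iff.2 subset_closure

theorem uniqueDiffOn_closure_unitSquare : UniqueDiffOn ℝ (closure unitSquare) :=
  uniqueDiffOn_convex convex_closure_unitSquare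
    (unitSquare_nonempty.mono unitSquare_subset_interior)

theorem isCompact_closure_unitSquare : IsCompact (closure unitSquare) := by
  have h : closure unitSquare = (EuclideanSpace.equiv (Fin 2) ℝ).toHomeomorph ⁻¹'
      Set.pi Set.univ fun _ => Set.Icc (0 : ℝ) 1 := by
    rw [closure_unitSquare]; ext x
    simp only [Set.mem_preimage, Set.mem_univ_pi]
    rfl
  rw [h, Homeomorph.isCompact_preimage]
  exact isCompact_univ_pi fun _ => isCompact_Icc

theorem mem_closure_unitSquare {x y : ℝ} :
    !₂[x, y] ∈ closure unitSquare ↔ x ∈ Set.Icc (0 : ℝ) 1 ∧ y ∈ Set.Icc (0 : ℝ) 1 := by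
  rw [closure_unitSquare]
  simp [Fin.forall_fin_two]

/-- The directional derivative on the closed unit square. -/
noncomputable def dirDeriv (v : Plane) (g : Plane → ℝ) : Plane → ℝ :=
  fun x => fderivWithin ℝ g (closure unitSquare) x v

theorem dirDeriv_congr (v : Plane) {g g' : Plane → ℝ}
    (h : Set.EqOn g g' (closure unitSquare)) :
    Set.EqOn (dirDeriv v g) (dirDeriv v g') (closure unitSquare) := fun x hx => by
  unfold dirDeriv; rw [fderivWithin_congr h (h hx)]

theorem contDiffOn_dirDeriv (v : Plane) {g : Plane → ℝ} {n : ℕ}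
    (hg : ContDiffOn ℝ (n + 1 : ℕ) g (closure unitSquare)) :
    ContDiffOn ℝ n (dirDeriv v g) (closure unitSquare) :=
  (hg.fderivWithin uniqueDiffOn_closure_unitSquare (by norm_cast)).clm_apply contDiffOn_const

theorem contDiffOn_dirDeriv_iterate (v : Plane) {g : Plane → ℝ} {n : ℕ} (a : ℕ)
    (hg : ContDiffOn ℝ (n + a : ℕ) g (closure unitSquare)) :
    ContDiffOn ℝ n ((dirDeriv v)^[a] g) (closure unitSquare) := by
  induction a generalizing g with
  | zero => exact hg
  | succ a ih => exact ih (contDiffOn_dirDeriv v hg)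

theorem dirDeriv_dirDeriv {g : Plane → ℝ} {n : ℕ}
    (hg : ContDiffOn ℝ (n + 2 : ℕ) g (closure unitSquare)) (v w : Plane) {x : Plane}
    (hx : x ∈ closure unitSquare) :
    dirDeriv v (dirDeriv w g) x
      = fderivWithin ℝ (fderivWithin ℝ g (closure unitSquare)) (closure unitSquare) x v w := by
  have h : ContDiffOn ℝ (n + 1 : ℕ) (fderivWithin ℝ g (closure unitSquare))
      (closure unitSquare) :=
    hg.fderivWithin uniqueDiffOn_closure_unitSquare (by norm_cast)
  have hd := (h.differentiableOn (by norm_cast)) x hx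
  unfold dirDeriv
  rw [fderivWithin_clm_apply (uniqueDiffOn_closure_unitSquare x hx) hd
    (differentiableWithinAt_const w)]
  simp

theorem dirDeriv_comm {g : Plane → ℝ} {n : ℕ}
    (hg : ContDiffOn ℝ (n + 2 : ℕ) g (closure unitSquare)) (v w : Plane) :
    Set.EqOn (dirDeriv v (dirDeriv w g)) (dirDeriv w (dirDeriv v g)) (closure unitSquare) := by
  intro x hx
  rw [dirDeriv_dirDeriv hg v w hx, dirDeriv_dirDeriv hg w v hx]
  refine ContDiffWithinAt.isSymmSndFDerivWithinAt (hg x hx) ?_ uniqueDiffOn_closure_unitSquare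
    (closure_mono unitSquare_subset_interior hx) hx v w
  rw [minSmoothness_of_isRCLikeNormedField]
  norm_cast; omega

theorem dirDeriv_iterate_comm {g : Plane → ℝ} {n : ℕ} (a : ℕ)
    (hg : ContDiffOn ℝ (n + a + 1 : ℕ) g (closure unitSquare)) (v w : Plane) :
    Set.EqOn (dirDeriv v ((dirDeriv w)^[a] g)) ((dirDeriv w)^[a] (dirDeriv v g))
      (closure unitSquare) := by
  induction a generalizing n with
  | zero => exact fun x _ => rfl
  | succ a ih =>
    rw [Function.iterate_succ_apply', Function.iterate_succ_apply']
    have h1 : ContDiffOn ℝ (n + 2 : ℕ) ((dirDeriv w)^[a] g) (closure unitSquare) :=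
      contDiffOn_dirDeriv_iterate w a (by rwa [show n + 2 + a = n + (a + 1) + 1 by omega])
    refine (dirDeriv_comm h1 v w).trans (dirDeriv_congr w ?_)
    exact ih (n := n + 1) (by rwa [show n + 1 + a + 1 = n + (a + 1) + 1 by omega])

/-- The derivative in the parameter is two-sided even when the segment lies in an edge of the
square, because the whole open segment stays in the closed square. -/
theorem hasDerivAt_comp_line {g : Plane → ℝ} {n : ℕ}
    (hg : ContDiffOn ℝ (n + 1 : ℕ) g (closure unitSquare)) {c : ℝ → Plane} {v : Plane}
    {s : ℝ} (hc : ∀ t ∈ Set.Ioo (0 : ℝ) 1, c t ∈ closure unitSquare)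
    (hd : HasDerivAt c v s) (hs : s ∈ Set.Ioo (0 : ℝ) 1) :
    HasDerivAt (fun t => g (c t)) (dirDeriv v g (c s)) s := by
  have h1 : HasFDerivWithinAt g (fderivWithin ℝ g (closure unitSquare) (c s))
      (closure unitSquare) (c s) :=
    ((hg.differentiableOn (by norm_cast)) _ (hc s hs)).hasFDerivWithinAt
  have h2 := h1.comp_hasDerivWithinAt s (hd.hasDerivWithinAt (s := Set.Ioo 0 1)) hc
  exact h2.hasDerivAt (isOpen_Ioo.mem_nhds hs)

/-- The coordinate vectors. -/
noncomputable def basisVec (k : Fin 2) : Plane := EuclideanSpace.basisFun (Fin 2) ℝ k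

theorem hasDerivAt_fst (y s : ℝ) : HasDerivAt (fun t : ℝ => (!₂[t, y] : Plane)) (basisVec 0) s := by
  have e : (fun t : ℝ => (!₂[t, y] : Plane)) = fun t => t • basisVec 0 + !₂[0, y] := by
    funext t; ext k; fin_cases k <;> simp [basisVec]
  rw [e]
  simpa using ((hasDerivAt_id s).smul_const (basisVec 0)).add_const (!₂[0, y] : Plane)

theorem hasDerivAt_snd (x s : ℝ) : HasDerivAt (fun t : ℝ => (!₂[x, t] : Plane)) (basisVec 1) s := by
  have e : (fun t : ℝ => (!₂[x, t] : Plane)) = fun t => t • basisVec 1 + !₂[x, 0] := by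
    funext t; ext k; fin_cases k <;> simp [basisVec]
  rw [e]
  simpa using ((hasDerivAt_id s).smul_const (basisVec 1)).add_const (!₂[x, 0] : Plane)

/-- The mixed partial derivatives `∂ₓᵃ ∂ᵧᵇ w` on the closed unit square. -/
noncomputable def partialDeriv (w : Plane → ℝ) (a b : ℕ) : Plane → ℝ :=
  (dirDeriv (basisVec 0))^[a] ((dirDeriv (basisVec 1))^[b] w)

theorem contDiffOn_partialDeriv {w : Plane → ℝ} (hw : ContDiffOn ℝ 6 w (closure unitSquare))
    {a b n : ℕ} (h : a + b + n ≤ 6) :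
    ContDiffOn ℝ n (partialDeriv w a b) (closure unitSquare) :=
  contDiffOn_dirDeriv_iterate _ a (contDiffOn_dirDeriv_iterate _ b
    (hw.of_le (by norm_cast; omega)))

/-- `partialDeriv` applies the `y`-derivatives first, so one more `x`-derivative is immediate, while
one more `y`-derivative must be commuted past the `x`-derivatives by symmetry of second derivatives.
-/
theorem partialDeriv_succ_right {w : Plane → ℝ} (hw : ContDiffOn ℝ 6 w (closure unitSquare))
    {a b : ℕ} (h : a + b < 6) :
    Set.EqOn (dirDeriv (basisVec 1) (partialDeriv w a b)) (partialDeriv w a (b + 1))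
      (closure unitSquare) := by
  have := dirDeriv_iterate_comm (n := 0) (g := (dirDeriv (basisVec 1))^[b] w) a
    (contDiffOn_dirDeriv_iterate _ b (hw.of_le (by norm_cast; omega)))
    (basisVec 1) (basisVec 0)
  rw [← Function.iterate_succ_apply' (dirDeriv (basisVec 1)) b w] at this
  exact this

theorem exists_isDerivTable {w : Plane → ℝ} (hw : ContDiffOn ℝ 6 w (closure unitSquare)) :
    ∃ M, 0 ≤ M ∧ IsDerivTable (fun a b x y => partialDeriv w a b !₂[x, y]) M := by
  have hcont : ∀ a b, a + b ≤ 6 → ContinuousOn (partialDeriv w a b) (closure unitSquare) :=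
    fun a b h => (contDiffOn_partialDeriv hw (n := 0) (by omega)).continuousOn
  -- A finite index type containing all orders up to six, so that the bounds can be summed into one.
  have hb : ∀ ab : Fin 7 × Fin 7, ∃ M, ab.1.1 + ab.2.1 ≤ 6 → ∀ x ∈ closure unitSquare,
      ‖partialDeriv w ab.1 ab.2 x‖ ≤ M := by
    intro ab
    by_cases h : ab.1.1 + ab.2.1 ≤ 6
    · obtain ⟨M, hM⟩ := isCompact_closure_unitSquare.exists_bound_of_continuousOn (hcont _ _ h)
      exact ⟨M, fun _ => hM⟩
    · exact ⟨0, fun h' => absurd h' h⟩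
  choose B hB using hb
  refine ⟨∑ ab, |B ab|, Finset.sum_nonneg fun _ _ => abs_nonneg _, ?_, ?_, ?_⟩
  · intro a b n h y hy
    refine ⟨fun k hk => ?_, fun k hk s hs => ?_⟩
    · refine (hcont (a + k) b (by omega)).comp
        (fun s _ => (hasDerivAt_fst y s).continuousAt.continuousWithinAt) fun s hs => ?_
      exact mem_closure_unitSquare.2 ⟨hs, hy⟩
    · have := hasDerivAt_comp_line (n := 0)
        (contDiffOn_partialDeriv hw (a := a + k) (b := b) (by omega))
        (fun t ht => mem_closure_unitSquare.2 ⟨Set.Ioo_subset_Icc_self ht, hy⟩)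
        (hasDerivAt_fst y s) hs
      refine this.congr_deriv ?_
      unfold partialDeriv
      rw [← add_assoc, Function.iterate_succ_apply']
  · intro a b n h x hx
    refine ⟨fun k hk => ?_, fun k hk s hs => ?_⟩
    · refine (hcont a (b + k) (by omega)).comp
        (fun s _ => (hasDerivAt_snd x s).continuousAt.continuousWithinAt) fun s hs => ?_
      exact mem_closure_unitSquare.2 ⟨hx, hs⟩
    · have := hasDerivAt_comp_line (n := 0)
        (contDiffOn_partialDeriv hw (a := a) (b := b + k) (by omega))
        (fun t ht => mem_closure_unitSquare.2 ⟨hx, Set.Ioo_subset_Icc_self ht⟩)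
        (hasDerivAt_snd x s) hs
      refine this.congr_deriv ?_
      rw [← add_assoc]
      exact partialDeriv_succ_right hw (by omega)
        (mem_closure_unitSquare.2 ⟨hx, Set.Ioo_subset_Icc_self hs⟩)
  · intro a b h x hx y hy
    have h1 := hB (⟨a, by omega⟩, ⟨b, by omega⟩) h !₂[x, y] (mem_closure_unitSquare.2 ⟨hx, hy⟩)
    have h2 := Finset.single_le_sum (f := fun ab => |B ab|) (fun _ _ => abs_nonneg _)
      (Finset.mem_univ ((⟨a, by omega⟩, ⟨b, by omega⟩) : Fin 7 × Fin 7))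
    exact h1.trans ((le_abs_self _).trans h2)

/-- The Laplacian, extended continuously to the closed unit square. -/
noncomputable def closedLaplacian (w : Plane → ℝ) : Plane → ℝ :=
  fun x => partialDeriv w 2 0 x + partialDeriv w 0 2 x

theorem continuousOn_closedLaplacian {w : Plane → ℝ}
    (hw : ContDiffOn ℝ 6 w (closure unitSquare)) :
    ContinuousOn (closedLaplacian w) (closure unitSquare) :=
  (contDiffOn_partialDeriv hw (n := 0) (by norm_num)).continuousOn.add
    (contDiffOn_partialDeriv hw (n := 0) (by norm_num)).continuousOn

theorem closedLaplacian_eq {w : Plane → ℝ} (hw : ContDiffOn ℝ 6 w (closure unitSquare))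
    {x : Plane} (hx : x ∈ unitSquare) : closedLaplacian w x = Laplacian.laplacian w x := by
  have hw' : ContDiffOn ℝ (4 + 2 : ℕ) w (closure unitSquare) := hw.of_le (by norm_cast)
  have hmem : closure unitSquare ∈ nhds x :=
    Filter.mem_of_superset (isOpen_unitSquare.mem_nhds hx) subset_closure
  rw [InnerProductSpace.laplacian_eq_iteratedFDeriv_orthonormalBasis w
    (EuclideanSpace.basisFun (Fin 2) ℝ)]
  simp only [Fin.sum_univ_two, iteratedFDeriv_two_apply]
  unfold closedLaplacian
  rw [show partialDeriv w 2 0 = dirDeriv (basisVec 0) (dirDeriv (basisVec 0) w) from rfl,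
    show partialDeriv w 0 2 = dirDeriv (basisVec 1) (dirDeriv (basisVec 1) w) from rfl,
    dirDeriv_dirDeriv hw' _ _ (subset_closure hx), dirDeriv_dirDeriv hw' _ _ (subset_closure hx),
    fderivWithin_fderivWithin_eq_of_mem_nhds hmem]
  rfl

/-- Extends the optimality equations to the boundary; this is where continuity of `f` and `g` on the
closed square enters. -/
theorem eqOn_closure_unitSquare {φ ψ : Plane → ℝ} (h : Set.EqOn φ ψ unitSquare)
    (hφ : ContinuousOn φ (closure unitSquare)) (hψ : ContinuousOn ψ (closure unitSquare)) :
    Set.EqOn φ ψ (closure unitSquare) :=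
  h.of_subset_closure hφ hψ subset_closure le_rfl

/-! ### Error estimate -/

theorem grid_mem_Icc {N : ℕ} (hN : 1 ≤ N) {i : ℤ} (h0 : 0 ≤ i) (h1 : i ≤ N) :
    (i : ℝ) * (1 / N) ∈ Set.Icc (0 : ℝ) 1 := by
  have hN' : (0 : ℝ) < N := by positivity
  have h0' : (0 : ℝ) ≤ i := by exact_mod_cast h0
  have h1' : (i : ℝ) ≤ N := by exact_mod_cast h1
  rw [mul_one_div]
  exact ⟨by positivity, (div_le_one hN').2 h1'⟩

theorem grid_mem_frontier {N : ℕ} (hN : 1 ≤ N) {i j : ℤ} (h0 : 0 ≤ i) (h1 : i ≤ N) (h2 : 0 ≤ j)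
    (h3 : j ≤ N) (h : (i, j) ∉ interiorIdx N) :
    !₂[(i : ℝ) * (1 / N), (j : ℝ) * (1 / N)] ∈ frontier unitSquare := by
  have hN' : (N : ℝ) ≠ 0 := by positivity
  rw [isOpen_unitSquare.frontier_eq]
  refine ⟨mem_closure_unitSquare.2 ⟨grid_mem_Icc hN h0 h1, grid_mem_Icc hN h2 h3⟩, fun hmem => h ?_⟩
  have key : ∀ {k : ℤ}, 0 ≤ k → k ≤ N → (k : ℝ) * (1 / N) ∈ Set.Ioo (0 : ℝ) 1 →
      1 ≤ k ∧ k ≤ N - 1 := by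
    intro k hk0 hk1 hk
    have a0 : k ≠ 0 := by rintro rfl; simp at hk
    have a1 : k ≠ N := by
      rintro rfl
      have := hk.2
      push_cast at this
      rw [mul_one_div_cancel hN'] at this
      exact lt_irrefl _ this
    omega
  rw [mem_interiorIdx]
  exact ⟨key h0 h1 (by simpa using hmem 0), key h2 h3 (by simpa using hmem 1)⟩

theorem zeroBdry_sample {N : ℕ} (hN : 1 ≤ N) {w : Plane → ℝ}
    (hw : ∀ x ∈ frontier unitSquare, w x = 0) : ZeroBdry N (sample (1 / N) w) :=
  fun _ _ h0 h1 h2 h3 h => hw _ (grid_mem_frontier hN h0 h1 h2 h3 h)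

/-- Fourth-order consistency on the grid, with the Laplacian taken up to the boundary. -/
theorem exists_consistency {w : Plane → ℝ} (hw : ContDiffOn ℝ 6 w (closure unitSquare)) :
    ∃ C, 0 ≤ C ∧ ∀ N : ℕ, 1 ≤ N → ∀ i j, (i, j) ∈ interiorIdx N →
      |opF (1 / N) (sample (1 / N) w) i j + opR (sample (1 / N) (closedLaplacian w)) i j|
        ≤ C * (1 / (N : ℝ)) ^ 4 := by
  obtain ⟨M, hM, H⟩ := exists_isDerivTable hw
  refine ⟨7 * M, by positivity, fun N hN i j hij => ?_⟩
  rw [mem_interiorIdx] at hij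
  have hN' : (0 : ℝ) < N := by positivity
  have ep : ∀ k : ℤ, ((k + 1 : ℤ) : ℝ) * (1 / N) = k * (1 / N) + 1 / N := by
    intro k; push_cast; ring
  have em : ∀ k : ℤ, ((k - 1 : ℤ) : ℝ) * (1 / N) = k * (1 / N) - 1 / N := by
    intro k; push_cast; ring
  have b1 := (grid_mem_Icc hN (i := i - 1) (by omega) (by omega)).1
  have b2 := (grid_mem_Icc hN (i := i + 1) (by omega) (by omega)).2
  have b3 := (grid_mem_Icc hN (i := j - 1) (by omega) (by omega)).1
  have b4 := (grid_mem_Icc hN (i := j + 1) (by omega) (by omega)).2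
  rw [em] at b1 b3
  rw [ep] at b2 b4
  have := H.consistency (by positivity : (0 : ℝ) < 1 / N) hM b1 b2 b3 b4
  dsimp only at this
  refine le_of_eq_of_le ?_ this
  simp only [opF, opR, sample, closedLaplacian, ep, em]
  rfl

theorem maxNorm_le {N : ℕ} {v : GridFun} {c : ℝ} (hc : 0 ≤ c)
    (h : ∀ i j, (i, j) ∈ interiorIdx N → |v i j| ≤ c) : maxNorm N v ≤ c := by
  unfold maxNorm
  have : ((interiorIdx N).sup fun ij => ‖v ij.1 ij.2‖₊) ≤ (⟨c, hc⟩ : ℝ≥0) :=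
    Finset.sup_le fun ij hij => h ij.1 ij.2 hij
  exact this

theorem opR_congr {N : ℕ} {v w : GridFun}
    (h : ∀ i j : ℤ, 0 ≤ i → i ≤ N → 0 ≤ j → j ≤ N → v i j = w i j) {i j : ℤ}
    (hij : (i, j) ∈ interiorIdx N) : opR v i j = opR w i j := by
  rw [mem_interiorIdx] at hij
  unfold opR
  repeat rw [h _ _ (by omega) (by omega) (by omega) (by omega)]

theorem opF_congr {N : ℕ} {v w : GridFun} (s : ℝ)
    (h : ∀ i j : ℤ, 0 ≤ i → i ≤ N → 0 ≤ j → j ≤ N → v i j = w i j) {i j : ℤ}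
    (hij : (i, j) ∈ interiorIdx N) : opF s v i j = opF s w i j := by
  rw [mem_interiorIdx] at hij
  unfold opF
  repeat rw [h _ _ (by omega) (by omega) (by omega) (by omega)]

end EllipticControl

open EllipticControl in
theorem theorem5 (α : ℝ) (hα : 0 < α)
    (f g z u p : EuclideanSpace ℝ (Fin 2) → ℝ)
    (hf : ContinuousOn f (closure unitSquare))
    (hg : ContinuousOn g (closure unitSquare))
    (hg0 : ∀ x ∈ frontier unitSquare, g x = 0)
    (hKKT : IsC6KKTSolution α f g z u p) :
    ∃ C : ℝ, ∀ N : ℕ, 1 ≤ N → ∀ γ : ℝ, 0 ≤ γ →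
      (∃! s : GridFun × GridFun × GridFun,
        IsDO4TrapRegSolution α γ N (sample (1 / N) f) (sample (1 / N) g) s.1 s.2.1 s.2.2) ∧
      ∀ zh uh ph : GridFun,
        IsDO4TrapRegSolution α γ N (sample (1 / N) f) (sample (1 / N) g) zh uh ph →
          maxNorm N (sample (1 / N) z - zh) ≤ C * (1 / (N : ℝ)) ^ 4 ∧
          maxNorm N (sample (1 / N) u - uh) ≤ C * (1 / (N : ℝ)) ^ 4 := by
  obtain ⟨C₁, hC₁, H₁⟩ := exists_consistency hKKT.z_smooth
  obtain ⟨C₂, hC₂, H₂⟩ := exists_consistency hKKT.p_smooth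
  have cz := hKKT.z_smooth.continuousOn
  have cu := hKKT.u_smooth.continuousOn
  have cp := hKKT.p_smooth.continuousOn
  have hstate : Set.EqOn (closedLaplacian z) (fun x => -(u x + f x)) (closure unitSquare) :=
    eqOn_closure_unitSquare
      (fun x hx => by
        have := hKKT.state x hx
        rw [← closedLaplacian_eq hKKT.z_smooth hx] at this
        linarith)
      (continuousOn_closedLaplacian hKKT.z_smooth) (cu.add hf).neg
  have hadj : Set.EqOn (closedLaplacian p) (fun x => z x - g x) (closure unitSquare) :=
    eqOn_closure_unitSquare
      (fun x hx => by
        have := hKKT.adjoint x hx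
        rw [← closedLaplacian_eq hKKT.p_smooth hx] at this
        linarith)
      (continuousOn_closedLaplacian hKKT.p_smooth) (cz.sub hg)
  have hgrad : Set.EqOn p (fun x => α * u x) (closure unitSquare) :=
    eqOn_closure_unitSquare (fun x hx => by linarith [hKKT.gradient x hx]) cp
      (continuousOn_const.mul cu)
  -- The control inherits the boundary condition of the adjoint, so its error also vanishes at the
  -- boundary grid points.
  have hu0 : ∀ x ∈ frontier unitSquare, u x = 0 := by
    intro x hx
    have h := hgrad (frontier_subset_closure hx)
    rw [hKKT.adjoint_bdry x hx] at h
    exact (mul_eq_zero.1 h.symm).resolve_left hα.ne'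
  -- Stability constant times the consistency constants of `z` and `p`; none of them involves `γ` or
  -- `N`.
  refine ⟨(1 + 1 / α) * (C₁ + C₂), fun N hN γ hγ =>
    ⟨existsUnique_isDO4TrapRegSolution hα hγ hN _ _, fun zh uh ph hs => ?_⟩⟩
  have hz : ZeroBdry N (sample (1 / N) z - zh) := fun i j h0 h1 h2 h3 h => by
    rw [Pi.sub_apply, Pi.sub_apply, hs.z_ext i j h,
      zeroBdry_sample hN hKKT.state_bdry i j h0 h1 h2 h3 h, sub_zero]
  have hu : ZeroBdry N (sample (1 / N) u - uh) := fun i j h0 h1 h2 h3 h => by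
    rw [Pi.sub_apply, Pi.sub_apply, hs.u_ext i j h,
      zeroBdry_sample hN hu0 i j h0 h1 h2 h3 h, sub_zero]
  have hgrid : ∀ {i j : ℤ}, 0 ≤ i → i ≤ N → 0 ≤ j → j ≤ N →
      !₂[(i : ℝ) * (1 / N), (j : ℝ) * (1 / N)] ∈ closure unitSquare :=
    fun h0 h1 h2 h3 => mem_closure_unitSquare.2 ⟨grid_mem_Icc hN h0 h1, grid_mem_Icc hN h2 h3⟩
  have hpow : 0 ≤ (1 / (N : ℝ)) ^ 4 := by positivity
  have hτ : 0 ≤ (C₁ + C₂) * (1 / (N : ℝ)) ^ 4 := by positivity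
  have key := coupled_stability hα hN (cutoff_vanishesOff N _) (cutoff_vanishesOff N _) hτ
    (z := cutoff N (sample (1 / N) z - zh)) (u := cutoff N (sample (1 / N) u - uh))
    (fun i j hij => by
      rw [hz.opF_cutoff _ hij, hu.opR_cutoff hij, opF_sub, opR_sub]
      have e : opR (sample (1 / N) (closedLaplacian z)) i j
          = -(opR (sample (1 / N) u) i j + opR (sample (1 / N) f) i j) := by
        rw [opR_congr (v := sample (1 / N) (closedLaplacian z)) (w := fun k l => -(sample (1 / N) u k l + sample (1 / N) f k l))
          (fun k l h0 h1 h2 h3 => hstate (hgrid h0 h1 h2 h3)) hij]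
        simp only [opR]; ring
      have h1 := H₁ N hN i j hij
      rw [e] at h1
      have h2 := hs.state i j hij
      have e2 : (opF (1 / N) (sample (1 / N) z) - opF (1 / N) zh) i j
          - (opR (sample (1 / N) u) - opR uh) i j
          = opF (1 / N) (sample (1 / N) z) i j
            + -(opR (sample (1 / N) u) i j + opR (sample (1 / N) f) i j) := by
        rw [← h2]; simp only [Pi.sub_apply]; ring
      rw [e2]
      exact h1.trans (mul_le_mul_of_nonneg_right (by linarith) hpow))
    (fun i j hij => by
      rw [hu.opF_cutoff _ hij, hz.opR_cutoff hij, opF_sub, opR_sub]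
      have e : opR (sample (1 / N) (closedLaplacian p)) i j
          = opR (sample (1 / N) z) i j - opR (sample (1 / N) g) i j := by
        rw [opR_congr (v := sample (1 / N) (closedLaplacian p)) (w := sample (1 / N) z - sample (1 / N) g)
          (fun k l h0 h1 h2 h3 => hadj (hgrid h0 h1 h2 h3)) hij, opR_sub]
        rfl
      -- The residual of the control equation is the consistency error of `p = α u`.
      have e' : opF (1 / N) (sample (1 / N) p) i j = α * opF (1 / N) (sample (1 / N) u) i j := by
        rw [opF_congr (1 / N) (v := sample (1 / N) p) (w := α • sample (1 / N) u)
          (fun k l h0 h1 h2 h3 => hgrad (hgrid h0 h1 h2 h3)) hij]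
        exact congrFun (congrFun ((opFLin (1 / N)).map_smul α (sample (1 / N) u)) i) j
      have h1 := H₂ N hN i j hij
      rw [e, e'] at h1
      have h2 := hs.control_eq hγ (zeroBdry_sample hN hg0) hij
      have e2 : α * (opF (1 / N) (sample (1 / N) u) - opF (1 / N) uh) i j
          + (opR (sample (1 / N) z) - opR zh) i j
          = α * opF (1 / N) (sample (1 / N) u) i j
            + (opR (sample (1 / N) z) i j - opR (sample (1 / N) g) i j) := by
        rw [← h2]; simp only [Pi.sub_apply]; ring
      rw [e2]
      exact h1.trans (mul_le_mul_of_nonneg_right (by linarith) hpow))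
  have hC : 0 ≤ (1 + 1 / α) * (C₁ + C₂) * (1 / (N : ℝ)) ^ 4 := by positivity
  constructor
  · refine maxNorm_le hC fun i j hij => ?_
    have := (key i j).1
    rwa [cutoff, if_pos hij, ← mul_assoc] at this
  · refine maxNorm_le hC fun i j hij => ?_
    have := (key i j).2
    rwa [cutoff, if_pos hij, ← mul_assoc] at this
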